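/- For $\tau$ in the upper half plane and $z\in\mathbb C$ put $q^x=e^{2\pi i\tau x}$ and define, wherever no denominator vanishes, $$f_1(\tau,z)=\sum_{j\in\mathbb Z}\frac{e^{2\pi ijz}q^{\frac12j^2}}{1-e^{2\pi iz}q^j},\quad f_2(\tau,z)=\sum_{j\in\mathbb Z}(-1)^j\frac{e^{2\pi i(j+\frac12)z}q^{\frac12(j+\frac12)^2}}{1+e^{2\pi iz}q^{j+\frac12}},$$ $$f_3(\tau,z)=\sum_{j\in\mathbb Z}(-1)^j\frac{e^{2\pi ijz}q^{\frac12j^2}}{1+e^{2\pi iz}q^j},\quad f_4(\tau,z)=\sum_{j\in\mathbb Z}\frac{e^{2\pi i(j+\frac12)z}q^{\frac12(j+\frac12)^2}}{1-e^{2\pi iz}q^{j+\frac12}},$$ $$g_1(\tau,z)=\sum_{j\in\mathbb Z}\frac{e^{2\pi i(j-\frac12)z}q^{\frac12j(j-1)}}{1-e^{2\pi iz}q^j},\quad g_2(\tau,z)=\sum_{j\in\mathbb Z}(-1)^j\frac{e^{2\pi i(j-\frac12)z}q^{\frac12j(j-1)}}{1+e^{2\pi iz}q^j},$$ $$g_3(\tau,z)=\sum_{j\in\mathbb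 Z}\frac{e^{2\pi ijz}q^{\frac12(j^2-\frac14)}}{1-e^{2\pi iz}q^{j+\frac12}},\quad g_4(\tau,z)=\sum_{j\in\mathbb Z}(-1)^j\frac{e^{2\pi ijz}q^{\frac12(j^2-\frac14)}}{1+e^{2\pi iz}q^{j+\frac12}},$$ $$h_1(\tau,z)=\sum_{j\in\mathbb Z}(-1)^j\frac{e^{2\pi ijz}q^{\frac12j^2}}{1-e^{2\pi iz}q^j},\quad h_2(\tau,z)=\sum_{j\in\mathbb Z}(-1)^j\frac{e^{2\pi i(j+\frac12)z}q^{\frac12(j+\frac12)^2}}{1-e^{2\pi iz}q^{j+\frac12}},$$ $$h_3(\tau,z)=\sum_{j\in\mathbb Z}\frac{e^{2\pi ijz}q^{\frac12j^2}}{1+e^{2\pi iz}q^j},\quad h_4(\tau,z)=\sum_{j\in\mathbb Z}\frac{e^{2\pi i(j+\frac12)z}q^{\frac12(j+\frac12)^2}}{1+e^{2\pi iz}q^{j+\frac12}}.$$ Let $\tau\downarrow0$ mean $\tau=iT$ with $T>0$, $T\to0$. For a constant $C\in\mathbb C$, write $F\sim C\varphi$ if $F/\varphi\to C$ as $\tau\downarrow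 0$; for $C\neq0$ this is the usual asymptotic equivalence $F/(C\varphi)\to1$, and for $C=0$ it says $F=o(\varphi)$. Let $a\in\mathbb C$. Then, with $\varphi$ a power of $-i\tau$, times $e^{-\frac{\pi i}{4\tau}}$ where this factor appears, and $C$ the remaining factor: 1) if $a\notin\mathbb Z$, then $f_1(\tau,a\tau)\sim\frac12\cot(a\pi)\,(-i\tau)^{-1}$, $g_1(\tau,a\tau)\sim\frac12\cot(a\pi)\,(-i\tau)^{-1}$, $h_1(\tau,a\tau)\sim\frac1{2\sin(a\pi)}(-i\tau)^{-1}$; 2) if $a\notin\frac12+\mathbb Z$, then $f_4(\tau,a\tau)\sim-\frac12\tan(a\pi)\,(-i\tau)^{-1}$, $g_3(\tau,a\tau)\sim-\frac12\tan(a\pi)\,(-i\tau)^{-1}$, $h_2(\tau,a\tau)\sim\frac1{2\cos(a\pi)}(-i\tau)^{-1}$; 3) for every $a\in\mathbb C$, $f_2(\tau,a\tau)\sim\cos(a\pi)\,(-i\tau)^{-1}e^{-\frac{\pi i}{4\tau}}$, $f_3(\tau,a\tau)\sim\sin(a\pi)\,(-i\tau)^{-1}e^{-\frac{\pi i}{4\tau}}$,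 $g_2(\tau,a\tau)\sim-\cos(a\pi)\,(-i\tau)^{-1}e^{-\frac{\pi i}{4\tau}}$, $g_4(\tau,a\tau)\sim\sin(a\pi)\,(-i\tau)^{-1}e^{-\frac{\pi i}{4\tau}}$, $h_3(\tau,a\tau)\sim\frac12(-i\tau)^{-\frac12}$, $h_4(\tau,a\tau)\sim\frac12(-i\tau)^{-\frac12}$. -/

import Mathlib

noncomputable section

namespace Appell

open Complex Filter Topology Asymptotics

/-- `q ^ x` for `q = exp (2 π i τ)`, i.e. `exp (2 π i τ x)`. -/
def qPow (τ x : ℂ) : ℂ := exp (2 * Real.pi * I * τ * x)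

/-- `exp (2 π i x)`. -/
def e (x : ℂ) : ℂ := exp (2 * Real.pi * I * x)

def f₁ (τ z : ℂ) : ℂ :=
  ∑' j : ℤ, e (j * z) * qPow τ (1 / 2 * (j : ℂ) ^ 2) / (1 - e z * qPow τ j)

def f₂ (τ z : ℂ) : ℂ :=
  ∑' j : ℤ, (-1 : ℂ) ^ j * (e ((j + 1 / 2) * z) * qPow τ (1 / 2 * ((j : ℂ) + 1 / 2) ^ 2) /
    (1 + e z * qPow τ (j + 1 / 2)))

def f₃ (τ z : ℂ) : ℂ :=
  ∑' j : ℤ, (-1 : ℂ) ^ j * (e (j * z) * qPow τ (1 / 2 * (j : ℂ) ^ 2) / (1 + e z * qPow τ j))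

def f₄ (τ z : ℂ) : ℂ :=
  ∑' j : ℤ, e ((j + 1 / 2) * z) * qPow τ (1 / 2 * ((j : ℂ) + 1 / 2) ^ 2) /
    (1 - e z * qPow τ (j + 1 / 2))

def g₁ (τ z : ℂ) : ℂ :=
  ∑' j : ℤ, e ((j - 1 / 2) * z) * qPow τ (1 / 2 * j * (j - 1)) / (1 - e z * qPow τ j)

def g₂ (τ z : ℂ) : ℂ :=
  ∑' j : ℤ, (-1 : ℂ) ^ j *
    (e ((j - 1 / 2) * z) * qPow τ (1 / 2 * j * (j - 1)) / (1 + e z * qPow τ j))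

def g₃ (τ z : ℂ) : ℂ :=
  ∑' j : ℤ, e (j * z) * qPow τ (1 / 2 * ((j : ℂ) ^ 2 - 1 / 4)) /
    (1 - e z * qPow τ (j + 1 / 2))

def g₄ (τ z : ℂ) : ℂ :=
  ∑' j : ℤ, (-1 : ℂ) ^ j * (e (j * z) * qPow τ (1 / 2 * ((j : ℂ) ^ 2 - 1 / 4)) /
    (1 + e z * qPow τ (j + 1 / 2)))

def h₁ (τ z : ℂ) : ℂ :=
  ∑' j : ℤ, (-1 : ℂ) ^ j * (e (j * z) * qPow τ (1 / 2 * (j : ℂ) ^ 2) / (1 - e z * qPow τ j))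

def h₂ (τ z : ℂ) : ℂ :=
  ∑' j : ℤ, (-1 : ℂ) ^ j * (e ((j + 1 / 2) * z) * qPow τ (1 / 2 * ((j : ℂ) + 1 / 2) ^ 2) /
    (1 - e z * qPow τ (j + 1 / 2)))

def h₃ (τ z : ℂ) : ℂ :=
  ∑' j : ℤ, e (j * z) * qPow τ (1 / 2 * (j : ℂ) ^ 2) / (1 + e z * qPow τ j)

def h₄ (τ z : ℂ) : ℂ :=
  ∑' j : ℤ, e ((j + 1 / 2) * z) * qPow τ (1 / 2 * ((j : ℂ) + 1 / 2) ^ 2) /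
    (1 + e z * qPow τ (j + 1 / 2))

/-- The filter `τ ↓ 0`: `τ = i T` with `T > 0` real and `T → 0`. -/
def downZero : Filter ℂ := map (fun T : ℝ => I * (T : ℂ)) (𝓝[>] 0)

/-- `F(τ) ∼ C φ(τ)` as `τ ↓ 0`, with a constant `C`: the quotient `F / φ` tends to `C`,
and, if `C ≠ 0`, the functions `F` and `C φ` are asymptotically equivalent. For `C = 0`
only the first assertion (`F` is of smaller order than `φ`) is meaningful. -/
def LeadingAsymptotics (F : ℂ → ℂ) (C : ℂ) (φ : ℂ → ℂ) : Prop :=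
  Tendsto (fun τ => F τ / φ τ) downZero (𝓝 C) ∧
    (C ≠ 0 → F ~[downZero] fun τ => C * φ τ)

end Appell

end

/-!
At `τ = i T` and `z = a τ`, put `α = a` or `α = a + 1/2` and `w j = π T (j + α)`. Up to a factor
tending to `1`, each of the twelve functions is `∑ ε ^ j e ^ (-π T j²) e ^ (b w j) / (2 sinh (w j))`
or the same with `cosh`, where `ε = ±1`.

* For `sinh`, the pole part `1 / (2 w)` dominates and contributes `(2 π T)⁻¹ ∑ ε ^ j / (j + α)`,
  which the partial fractions of `cot` and `1 / sin` evaluate. The remainders are bounded and the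
  Gaussian leaves `O(T ^ (-1/2))` of them.
* For `cosh` and `ε = 1`, the quotient is close to `1 / 2` on the bulk of the Gaussian, whose sum is
  asymptotic to `T ^ (-1/2)`.
* For `cosh` and `ε = -1`, the sum cancels to all orders. With `t = 1 / T` and `β = b + 2 α`,
  Poisson summation turns it into a sum over `ξ ∈ 1/2 + ℤ` of Mordell integrals
  `∫ e ^ (-π t x² + 2 π i t ξ x + β π x) / (2 cosh (π x)) dx`. Moving the line of integration
  towards the poles `±i/2` shows that only `ξ = ±1/2` contribute to the order `e ^ (-π t / 4)`.
  There the saddle point `iξ` is itself a pole, and the two half residues add up to `cos (π b / 2)`.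
-/

noncomputable section

namespace Appell

open Complex Filter Topology Asymptotics MeasureTheory
open scoped FourierTransform

/-! ### Exponentials over hyperbolic functions -/

/-- The quotient `e ^ (b w) / (2 sinh w)`: with `w = π T (j + α)` it is, up to a Gaussian in `j`,
the general term of the series whose denominators contain a minus sign. -/
def expDivSinh (b w : ℂ) : ℂ := exp (b * w) / (2 * sinh w)

/-- The quotient `e ^ (b w) / (2 cosh w)`: with `w = π T (j + α)` it is, up to a Gaussian in `j`,
the general term of the series whose denominators contain a plus sign. -/
def expDivCosh (b w : ℂ) : ℂ := exp (b * w) / (2 * cosh w)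

lemma norm_exp_sub_one_le_norm_mul_exp (w : ℂ) : ‖exp w - 1‖ ≤ ‖w‖ * Real.exp ‖w‖ := by
  simpa using Complex.norm_exp_sub_sum_le_norm_mul_exp w 1

lemma norm_sinh_sub_self_le (w : ℂ) : ‖sinh w - w‖ ≤ ‖w‖ ^ 2 * Real.exp ‖w‖ := by
  have hpos := Complex.norm_exp_sub_sum_le_norm_mul_exp w 2
  have hneg := Complex.norm_exp_sub_sum_le_norm_mul_exp (-w) 2
  simp only [Finset.sum_range_succ, Finset.sum_range_zero, pow_zero, pow_one, Nat.factorial,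
    Nat.cast_one, div_one, zero_add, norm_neg, mul_one, Nat.succ_eq_add_one] at hpos hneg
  have hsplit : sinh w - w = ((exp w - (1 + w)) - (exp (-w) - (1 + -w))) / 2 := by
    rw [Complex.sinh]; ring
  rw [hsplit, norm_div, Complex.norm_ofNat]
  linarith [norm_sub_le (exp w - (1 + w)) (exp (-w) - (1 + -w))]

lemma norm_cosh_sub_one_le (w : ℂ) : ‖cosh w - 1‖ ≤ ‖w‖ * Real.exp ‖w‖ := by
  have hpos := norm_exp_sub_one_le_norm_mul_exp w
  have hneg := norm_exp_sub_one_le_norm_mul_exp (-w)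
  have hsplit : cosh w - 1 = ((exp w - 1) + (exp (-w) - 1)) / 2 := by
    rw [Complex.cosh]; ring
  rw [norm_neg] at hneg
  rw [hsplit, norm_div, Complex.norm_ofNat]
  linarith [norm_add_le (exp w - 1) (exp (-w) - 1)]

lemma norm_sinh_sq (w : ℂ) :
    ‖sinh w‖ ^ 2 = Real.sinh w.re ^ 2 + Real.sin w.im ^ 2 := by
  have hw : sinh w = (Real.sinh w.re * Real.cos w.im : ℝ) +
      (Real.cosh w.re * Real.sin w.im : ℝ) * I := by
    conv_lhs => rw [← re_add_im w, Complex.sinh_add, Complex.cosh_mul_I, Complex.sinh_mul_I]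
    push_cast
    ring
  rw [hw, ← normSq_eq_norm_sq, normSq_add_mul_I]
  linear_combination Real.sinh w.re ^ 2 * Real.sin_sq_add_cos_sq w.im +
    Real.sin w.im ^ 2 * Real.cosh_sq w.re

lemma norm_cosh_sq (w : ℂ) :
    ‖cosh w‖ ^ 2 = Real.sinh w.re ^ 2 + Real.cos w.im ^ 2 := by
  have hw : cosh w = (Real.cosh w.re * Real.cos w.im : ℝ) +
      (Real.sinh w.re * Real.sin w.im : ℝ) * I := by
    conv_lhs => rw [← re_add_im w, Complex.cosh_add, Complex.cosh_mul_I, Complex.sinh_mul_I]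
    push_cast
    ring
  rw [hw, ← normSq_eq_norm_sq, normSq_add_mul_I]
  linear_combination Real.sinh w.re ^ 2 * Real.sin_sq_add_cos_sq w.im +
    Real.cos w.im ^ 2 * Real.cosh_sq w.re

lemma two_div_pi_mul_norm_le_norm_sinh {w : ℂ} (hw : |w.im| ≤ Real.pi / 2) :
    2 / Real.pi * ‖w‖ ≤ ‖sinh w‖ := by
  have hpi : 2 / Real.pi ≤ 1 := (div_le_one Real.pi_pos).2 Real.two_le_pi
  have hre : 2 / Real.pi * |w.re| ≤ |Real.sinh w.re| :=
    (mul_le_of_le_one_left (abs_nonneg _) hpi).trans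
      (by rw [Real.abs_sinh]; exact Real.self_le_sinh_iff.2 (abs_nonneg _))
  have him : 2 / Real.pi * |w.im| ≤ |Real.sin w.im| := Real.mul_abs_le_abs_sin hw
  refine le_of_sq_le_sq ?_ (norm_nonneg _)
  rw [norm_sinh_sq, mul_pow, ← normSq_eq_norm_sq, normSq_apply, ← sq, ← sq, mul_add,
    ← sq_abs w.re, ← sq_abs w.im, ← mul_pow, ← mul_pow, ← sq_abs (Real.sinh _),
    ← sq_abs (Real.sin _)]
  gcongr

lemma sinh_ne_zero_of_abs_im_le {w : ℂ} (hw : |w.im| ≤ Real.pi / 2) (h0 : w ≠ 0) :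
    sinh w ≠ 0 := by
  have hpos : 0 < 2 / Real.pi * ‖w‖ := by positivity
  exact norm_pos_iff.1 (hpos.trans_le (two_div_pi_mul_norm_le_norm_sinh hw))

lemma half_le_norm_cosh {w : ℂ} (hw : |w.im| ≤ Real.pi / 3) : 1 / 2 ≤ ‖cosh w‖ := by
  have hcos : 1 / 2 ≤ Real.cos w.im := by
    rw [← Real.cos_pi_div_three, ← Real.cos_abs w.im]
    exact Real.cos_le_cos_of_nonneg_of_le_pi (abs_nonneg _) (by linarith [Real.pi_pos]) hw
  refine le_of_sq_le_sq ?_ (norm_nonneg _)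
  rw [norm_cosh_sq]
  nlinarith [sq_nonneg (Real.sinh w.re)]

lemma cosh_ne_zero_of_abs_im_le {w : ℂ} (hw : |w.im| ≤ Real.pi / 3) : cosh w ≠ 0 :=
  norm_pos_iff.1 (one_half_pos.trans_le (half_le_norm_cosh hw))

lemma norm_mul_mul_exp_add_norm_mul_exp_le (b w : ℂ) :
    ‖b * w‖ * Real.exp ‖b * w‖ + ‖w‖ * Real.exp ‖w‖ ≤
      (‖b‖ + 1) * ‖w‖ * Real.exp ((‖b‖ + 1) * ‖w‖) := by
  have hb : Real.exp ‖b * w‖ ≤ Real.exp ((‖b‖ + 1) * ‖w‖) := by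
    rw [norm_mul]
    gcongr
    linarith
  have h1 : Real.exp ‖w‖ ≤ Real.exp ((‖b‖ + 1) * ‖w‖) := by
    gcongr
    exact le_mul_of_one_le_left (norm_nonneg w) (by linarith [norm_nonneg b])
  calc _ ≤ ‖b * w‖ * Real.exp ((‖b‖ + 1) * ‖w‖) + ‖w‖ * Real.exp ((‖b‖ + 1) * ‖w‖) := by gcongr
    _ = _ := by rw [norm_mul]; ring

lemma norm_expDivSinh_sub_inv_le (b : ℂ) {w : ℂ} (hw : |w.im| ≤ Real.pi / 2) :
    ‖expDivSinh b w - (2 * w)⁻¹‖ ≤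
      Real.pi / 4 * (‖b‖ + 1) * Real.exp ((‖b‖ + 1) * ‖w‖) := by
  rcases eq_or_ne w 0 with rfl | h0
  · simp only [expDivSinh, Complex.sinh_zero, mul_zero, div_zero, inv_zero, sub_zero, norm_zero]
    positivity
  have hsinh := sinh_ne_zero_of_abs_im_le hw h0
  have hsplit : expDivSinh b w - (2 * w)⁻¹ =
      (w * (exp (b * w) - 1) - (sinh w - w)) / (2 * w * sinh w) := by
    rw [expDivSinh]
    field_simp
    ring
  have hnum : ‖w * (exp (b * w) - 1) - (sinh w - w)‖ ≤
      ‖w‖ * ((‖b‖ + 1) * ‖w‖ * Real.exp ((‖b‖ + 1) * ‖w‖)) := by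
    calc _ ≤ ‖w‖ * ‖exp (b * w) - 1‖ + ‖sinh w - w‖ := by
          rw [← norm_mul]; exact norm_sub_le _ _
      _ ≤ ‖w‖ * (‖b * w‖ * Real.exp ‖b * w‖) + ‖w‖ ^ 2 * Real.exp ‖w‖ := by
          gcongr
          exacts [norm_exp_sub_one_le_norm_mul_exp _, norm_sinh_sub_self_le w]
      _ = ‖w‖ * (‖b * w‖ * Real.exp ‖b * w‖ + ‖w‖ * Real.exp ‖w‖) := by ring
      _ ≤ _ := by gcongr; exact norm_mul_mul_exp_add_norm_mul_exp_le b w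
  have hden : 4 / Real.pi * ‖w‖ ^ 2 ≤ ‖2 * w * sinh w‖ := by
    rw [norm_mul, norm_mul, Complex.norm_ofNat]
    calc _ = 2 * ‖w‖ * (2 / Real.pi * ‖w‖) := by ring
      _ ≤ _ := by gcongr; exact two_div_pi_mul_norm_le_norm_sinh hw
  rw [hsplit, norm_div]
  refine (div_le_div₀ (by positivity) hnum (by positivity) hden).trans_eq ?_
  field_simp

lemma norm_expDivCosh_le (b : ℂ) {w : ℂ} (hw : |w.im| ≤ Real.pi / 3) :
    ‖expDivCosh b w‖ ≤ Real.exp ‖b * w‖ := by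
  rw [expDivCosh, norm_div, norm_mul, Complex.norm_ofNat]
  exact (div_le_self (norm_nonneg _) (by linarith [half_le_norm_cosh hw])).trans
    (Complex.norm_exp_le_exp_norm _)

lemma norm_expDivCosh_sub_half_le (b : ℂ) {w : ℂ} (hw : |w.im| ≤ Real.pi / 3) :
    ‖expDivCosh b w - 1 / 2‖ ≤ (‖b‖ + 1) * ‖w‖ * Real.exp ((‖b‖ + 1) * ‖w‖) := by
  have hcosh := cosh_ne_zero_of_abs_im_le hw
  have hsplit : expDivCosh b w - 1 / 2 =
      ((exp (b * w) - 1) - (cosh w - 1)) / (2 * cosh w) := by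
    rw [expDivCosh]
    field_simp
    ring
  rw [hsplit, norm_div, norm_mul, Complex.norm_ofNat]
  calc _ ≤ ‖(exp (b * w) - 1) - (cosh w - 1)‖ :=
        div_le_self (norm_nonneg _) (by linarith [half_le_norm_cosh hw])
    _ ≤ ‖exp (b * w) - 1‖ + ‖cosh w - 1‖ := norm_sub_le _ _
    _ ≤ ‖b * w‖ * Real.exp ‖b * w‖ + ‖w‖ * Real.exp ‖w‖ :=
        add_le_add (norm_exp_sub_one_le_norm_mul_exp _) (norm_cosh_sub_one_le w)
    _ ≤ _ := norm_mul_mul_exp_add_norm_mul_exp_le b w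

/-! ### Gaussian sums -/

lemma summable_exp_neg_mul_int_sq {s : ℝ} (hs : 0 < s) :
    Summable fun j : ℤ => Real.exp (-s * (j : ℝ) ^ 2) := by
  have hdecay := (isLittleO_exp_neg_mul_sq_cocompact (a := (s : ℂ)) (by simpa using hs) (-2)).isBigO
  have hsum := summable_of_isBigO (Real.summable_abs_int_rpow one_lt_two)
    (hdecay.comp_tendsto Int.tendsto_coe_cofinite)
  refine hsum.norm.congr fun j => ?_
  simp [Complex.norm_exp, ← ofReal_pow, ← ofReal_mul, -ofReal_intCast]

lemma tendsto_tsum_exp_neg_mul_int_sq_atTop :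
    Tendsto (fun s : ℝ => ∑' j : ℤ, Real.exp (-s * (j : ℝ) ^ 2)) atTop (𝓝 1) := by
  have hterm : ∀ j : ℤ, Tendsto (fun s : ℝ => Real.exp (-s * (j : ℝ) ^ 2)) atTop
      (𝓝 (if j = 0 then 1 else 0)) := by
    intro j
    rcases eq_or_ne j 0 with rfl | hj
    · simp
    · have hsq : 0 < (j : ℝ) ^ 2 := by positivity
      rw [if_neg hj]
      exact Real.tendsto_exp_atBot.comp (tendsto_neg_atTop_atBot.atBot_mul_const hsq)
  have hlim := tendsto_tsum_of_dominated_convergence (summable_exp_neg_mul_int_sq one_pos) hterm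
    (by
      filter_upwards [eventually_ge_atTop 1] with s hs j
      rw [Real.norm_eq_abs, Real.abs_exp]
      gcongr)
  simpa using hlim

lemma tendsto_sqrt_mul_tsum_exp_neg_mul_int_sq {δ : ℝ} (hδ : 0 < δ) :
    Tendsto (fun T : ℝ => √T * ∑' j : ℤ, Real.exp (-(δ * T) * (j : ℝ) ^ 2)) (𝓝[>] 0)
      (𝓝 √(Real.pi / δ)) := by
  have hdual : Tendsto (fun T : ℝ => Real.pi ^ 2 / δ * T⁻¹) (𝓝[>] 0) atTop :=
    tendsto_inv_nhdsGT_zero.const_mul_atTop (by positivity)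
  have hlim := (tendsto_tsum_exp_neg_mul_int_sq_atTop.comp hdual).const_mul √(Real.pi / δ)
  rw [mul_one] at hlim
  refine hlim.congr' ?_
  filter_upwards [self_mem_nhdsWithin] with T hT
  have hT : 0 < T := hT
  have htheta := Real.tsum_exp_neg_mul_int_sq (a := δ * T / Real.pi) (by positivity)
  have hleft : ∀ j : ℤ, -Real.pi * (δ * T / Real.pi) * (j : ℝ) ^ 2 = -(δ * T) * (j : ℝ) ^ 2 := by
    intro j
    field_simp
  have hright : ∀ j : ℤ, -Real.pi / (δ * T / Real.pi) * (j : ℝ) ^ 2 =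
      -(Real.pi ^ 2 / δ * T⁻¹) * (j : ℝ) ^ 2 := by
    intro j
    field_simp
  simp_rw [hleft, hright] at htheta
  rw [Function.comp_apply, htheta, ← Real.sqrt_eq_rpow, ← mul_assoc, mul_one_div,
    ← Real.sqrt_div' _ (by positivity)]
  congr 2
  field_simp

lemma neg_mul_sq_add_mul_abs_le {δ : ℝ} (hδ : 0 < δ) (K x : ℝ) :
    -δ * x ^ 2 + K * |x| ≤ -(δ / 2) * x ^ 2 + K ^ 2 / (2 * δ) := by
  have hsquare : K ^ 2 / (2 * δ) = K * |x| - δ / 2 * x ^ 2 + (δ * |x| - K) ^ 2 / (2 * δ) := by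
    field_simp
    rw [sub_sq, mul_pow, sq_abs]
    ring
  have hnonneg : 0 ≤ (δ * |x| - K) ^ 2 / (2 * δ) := by positivity
  linarith

lemma exp_mul_neg_mul_sq_add_mul_abs_le {δ T : ℝ} (hδ : 0 < δ) (hT : 0 ≤ T) (K x : ℝ) :
    Real.exp (T * (-δ * x ^ 2 + K * |x|)) ≤
      Real.exp (K ^ 2 / (2 * δ) * T) * Real.exp (-(δ / 2 * T) * x ^ 2) := by
  rw [← Real.exp_add]
  refine Real.exp_le_exp.2 ?_
  calc _ ≤ T * (-(δ / 2) * x ^ 2 + K ^ 2 / (2 * δ)) :=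
        mul_le_mul_of_nonneg_left (neg_mul_sq_add_mul_abs_le hδ K x) hT
    _ = _ := by ring

lemma summable_exp_mul_neg_mul_int_sq_add_mul_abs {δ T : ℝ} (hδ : 0 < δ) (hT : 0 < T) (K : ℝ) :
    Summable fun j : ℤ => Real.exp (T * (-δ * (j : ℝ) ^ 2 + K * |(j : ℝ)|)) :=
  Summable.of_nonneg_of_le (fun _ => (Real.exp_pos _).le)
    (fun j => exp_mul_neg_mul_sq_add_mul_abs_le hδ hT.le K j)
    ((summable_exp_neg_mul_int_sq (by positivity)).mul_left _)

-- The sum of the bounding terms is `O(T / √T)`.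
lemma tendsto_tsum_zero_of_norm_le {F : ℝ → ℤ → ℂ} {B δ K : ℝ} (hδ : 0 < δ)
    (hF : ∀ᶠ T in 𝓝[>] 0, ∀ j : ℤ,
      ‖F T j‖ ≤ B * T * Real.exp (T * (-δ * (j : ℝ) ^ 2 + K * |(j : ℝ)|))) :
    Tendsto (fun T => ∑' j : ℤ, F T j) (𝓝[>] 0) (𝓝 0) := by
  have hT0 : Tendsto (fun T : ℝ => T) (𝓝[>] 0) (𝓝 0) := nhdsWithin_le_nhds
  have hexp : Tendsto (fun T : ℝ => Real.exp (K ^ 2 / (2 * δ) * T)) (𝓝[>] 0) (𝓝 1) :=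
    Continuous.tendsto' (by fun_prop) 0 1 (by simp) |>.mono_left nhdsWithin_le_nhds
  have hsqrt : Tendsto (fun T : ℝ => |B| * √T) (𝓝[>] 0) (𝓝 0) := by
    simpa using (Real.continuous_sqrt.tendsto' 0 0 Real.sqrt_zero |>.comp hT0).const_mul |B|
  have hbound := (hsqrt.mul hexp).mul
    (tendsto_sqrt_mul_tsum_exp_neg_mul_int_sq (half_pos hδ))
  simp only [zero_mul] at hbound
  refine squeeze_zero_norm' ?_ hbound
  filter_upwards [hF, self_mem_nhdsWithin] with T hFT hT
  have hT : 0 < T := hT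
  have hterm : ∀ j : ℤ, ‖F T j‖ ≤ |B| * T * Real.exp (K ^ 2 / (2 * δ) * T) *
      Real.exp (-(δ / 2 * T) * (j : ℝ) ^ 2) := fun j => by
    calc _ ≤ B * T * Real.exp (T * (-δ * (j : ℝ) ^ 2 + K * |(j : ℝ)|)) := hFT j
      _ ≤ |B| * T * (Real.exp (K ^ 2 / (2 * δ) * T) * Real.exp (-(δ / 2 * T) * (j : ℝ) ^ 2)) := by
          gcongr
          exacts [le_abs_self B, exp_mul_neg_mul_sq_add_mul_abs_le hδ hT.le K j]
      _ = _ := by ring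
  calc _ ≤ ∑' j : ℤ, |B| * T * Real.exp (K ^ 2 / (2 * δ) * T) *
          Real.exp (-(δ / 2 * T) * (j : ℝ) ^ 2) :=
        tsum_of_norm_bounded
          ((summable_exp_neg_mul_int_sq (by positivity)).mul_left _).hasSum hterm
    _ = |B| * (√T * √T) * Real.exp (K ^ 2 / (2 * δ) * T) *
          ∑' j : ℤ, Real.exp (-(δ / 2 * T) * (j : ℝ) ^ 2) := by
        rw [tsum_mul_left, Real.mul_self_sqrt hT.le]
    _ = _ := by ring

lemma tendsto_tsum_of_norm_sub_le {F G : ℝ → ℤ → ℂ} {L : ℂ} {B δ K : ℝ} (hδ : 0 < δ)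
    (hG : ∀ T > 0, Summable (G T)) (hlim : Tendsto (fun T => ∑' j : ℤ, G T j) (𝓝[>] 0) (𝓝 L))
    (hFG : ∀ᶠ T in 𝓝[>] 0, ∀ j : ℤ,
      ‖F T j - G T j‖ ≤ B * T * Real.exp (T * (-δ * (j : ℝ) ^ 2 + K * |(j : ℝ)|))) :
    Tendsto (fun T => ∑' j : ℤ, F T j) (𝓝[>] 0) (𝓝 L) := by
  have hsum := (tendsto_tsum_zero_of_norm_le hδ hFG).add hlim
  rw [zero_add] at hsum
  refine hsum.congr' ?_
  filter_upwards [hFG, self_mem_nhdsWithin] with T hFGT hT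
  have hdiff : Summable fun j => F T j - G T j :=
    Summable.of_norm_bounded
      ((summable_exp_mul_neg_mul_int_sq_add_mul_abs hδ hT K).mul_left (B * T)) hFGT
  rw [← hdiff.tsum_add (hG T hT)]
  simp only [sub_add_cancel]

/-! ### Partial fractions -/

lemma hasSum_div_sq_sub_int_sq {α : ℂ} (hα : α ∈ integerComplement) :
    HasSum (fun j : ℤ => α / (α ^ 2 - (j : ℂ) ^ 2)) (Real.pi * cot (Real.pi * α)) := by
  have hα0 : α ≠ 0 := integerComplement.ne_zero hα
  have hterm : ∀ n : ℕ, cotTerm α n / 2 = α / (α ^ 2 - ((n : ℂ) + 1) ^ 2) := by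
    intro n
    have hsub : α - ((n : ℂ) + 1) ≠ 0 := by
      simpa [sub_eq_add_neg, add_comm] using integerComplement_add_ne_zero hα (-((n : ℤ) + 1))
    have hadd : α + ((n : ℂ) + 1) ≠ 0 := by
      simpa using integerComplement_add_ne_zero hα ((n : ℤ) + 1)
    rw [cotTerm, sq_sub_sq, one_div, one_div, inv_add_inv hsub hadd, div_div,
      div_eq_div_iff (by simp [hsub, hadd]) (by simp [hsub, hadd])]
    ring
  have hpos : HasSum (fun n : ℕ => α / (α ^ 2 - ((n : ℂ) + 1) ^ 2))
      ((Real.pi * cot (Real.pi * α) - 1 / α) / 2) := by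
    rw [cot_series_rep' hα]
    exact ((summable_cotTerm hα).hasSum.div_const 2).congr_fun fun n => (hterm n).symm
  have hall := HasSum.of_add_one_of_neg_add_one
    (f := fun j : ℤ => α / (α ^ 2 - (j : ℂ) ^ 2)) (by simpa using hpos)
    (by simpa only [Int.cast_neg, neg_sq, Int.cast_add, Int.cast_natCast, Int.cast_one] using hpos)
  convert hall using 1
  simp only [Int.cast_zero]
  field_simp
  ring

lemma tsum_neg_one_zpow_mul {f : ℤ → ℂ} (hf : Summable f) :
    ∑' j : ℤ, (-1 : ℂ) ^ j * f j = 2 * ∑' j : ℤ, f (2 * j) - ∑' j : ℤ, f j := by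
  have hinj : Function.Injective fun j : ℤ => 2 * j := fun i j h => by simpa using h
  have heven : HasSum (Set.indicator (Set.range fun j : ℤ => 2 * j) f) (∑' j : ℤ, f (2 * j)) :=
    hasSum_subtype_iff_indicator.1
      (hinj.hasSum_range_iff.2 (hf.comp_injective hinj).hasSum)
  rw [← ((heven.mul_left 2).sub hf.hasSum).tsum_eq]
  refine tsum_congr fun j => ?_
  rcases Int.even_or_odd' j with ⟨k, rfl | rfl⟩
  · rw [Set.indicator_of_mem (Set.mem_range_self k), (even_two_mul k).neg_one_zpow]
    ring
  · rw [Set.indicator_of_notMem (by rintro ⟨l, hl⟩; simp only at hl; omega),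
      (odd_two_mul_add_one k).neg_one_zpow]
    ring

lemma cot_div_two_sub_cot {x : ℂ} (hx : sin x ≠ 0) : cot (x / 2) - cot x = 1 / sin x := by
  obtain ⟨y, rfl⟩ : ∃ y, x = 2 * y := ⟨x / 2, by ring⟩
  rw [mul_div_cancel_left₀ y two_ne_zero, cot_eq_cos_div_sin, cot_eq_cos_div_sin]
  rw [Complex.sin_two_mul] at hx ⊢
  have hsin : sin y ≠ 0 := fun h => hx (by simp [h])
  have hcos : cos y ≠ 0 := fun h => hx (by simp [h])
  rw [Complex.cos_two_mul]
  field_simp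
  ring

lemma tsum_neg_one_zpow_mul_div_sq_sub_int_sq {α : ℂ} (hα : α ∈ integerComplement) :
    ∑' j : ℤ, (-1 : ℂ) ^ j * (α / (α ^ 2 - (j : ℂ) ^ 2)) = Real.pi / sin (Real.pi * α) := by
  have hα2 : α / 2 ∈ integerComplement := by
    rintro ⟨n, hn⟩
    exact hα ⟨2 * n, by push_cast; rw [hn]; ring⟩
  have heven : ∀ j : ℤ, α / (α ^ 2 - ((2 * j : ℤ) : ℂ) ^ 2) =
      1 / 2 * (α / 2 / ((α / 2) ^ 2 - (j : ℂ) ^ 2)) := by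
    intro j
    have hden : α ^ 2 - ((2 * j : ℤ) : ℂ) ^ 2 = 4 * ((α / 2) ^ 2 - (j : ℂ) ^ 2) := by
      push_cast
      ring
    rw [hden]
    field_simp
    ring
  rw [tsum_neg_one_zpow_mul (hasSum_div_sq_sub_int_sq hα).summable]
  simp_rw [heven]
  rw [tsum_mul_left, (hasSum_div_sq_sub_int_sq hα2).tsum_eq, (hasSum_div_sq_sub_int_sq hα).tsum_eq,
    div_eq_mul_one_div _ (sin _), ← cot_div_two_sub_cot (sin_pi_mul_ne_zero hα)]
  ring_nf

lemma tsum_mul_inv_int_add {α : ℂ} (hα : α ∈ integerComplement) {c : ℤ → ℂ}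
    (heven : ∀ j, c (-j) = c j) (hsum : Summable fun j : ℤ => c j * ((j : ℂ) + α)⁻¹) :
    ∑' j : ℤ, c j * ((j : ℂ) + α)⁻¹ = ∑' j : ℤ, c j * (α / (α ^ 2 - (j : ℂ) ^ 2)) := by
  have hneg := (Equiv.neg ℤ).hasSum_iff.2 hsum.hasSum
  have havg := ((hsum.hasSum.add hneg).div_const 2).tsum_eq
  rw [← two_mul, mul_div_cancel_left₀ _ two_ne_zero] at havg
  rw [← havg]
  refine tsum_congr fun j => ?_
  have hadd : (j : ℂ) + α ≠ 0 := by
    simpa [add_comm] using integerComplement_add_ne_zero hα j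
  have hsub : -(j : ℂ) + α ≠ 0 := by
    simpa [add_comm] using integerComplement_add_ne_zero hα (-j)
  have hden : α ^ 2 - (j : ℂ) ^ 2 = (j + α) * (-j + α) := by ring
  rw [Function.comp_apply, Equiv.neg_apply, heven, Int.cast_neg, hden]
  field_simp
  ring

/-! ### The series near `T = 0` when the general term does not oscillate away -/

/-- The series `∑ ε ^ j e ^ (-π T j²) F (π T (j + α))` over `j ∈ ℤ`. Up to an exponential factor
that tends to `1`, each Appell function at `τ = i T`, `z = a τ` has this form, with `ε = ±1`,
`α ∈ {a, a + 1/2}` and `F` one of the quotients `expDivSinh b`, `expDivCosh b`. -/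
def appellSum (ε : ℂ) (F : ℂ → ℂ) (α : ℂ) (T : ℝ) : ℂ :=
  ∑' j : ℤ, ε ^ j * ((Real.exp (-(Real.pi * T) * (j : ℝ) ^ 2) : ℂ) * F (Real.pi * T * (j + α)))

lemma norm_pi_mul_mul_add_le {T : ℝ} (hT : 0 ≤ T) (x : ℝ) (α : ℂ) :
    ‖Real.pi * T * (x + α)‖ ≤ Real.pi * T * (|x| + ‖α‖) := by
  rw [norm_mul, ← ofReal_mul, Complex.norm_of_nonneg (mul_nonneg Real.pi_pos.le hT)]
  gcongr
  simpa using norm_add_le (x : ℂ) α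

lemma abs_im_pi_mul_le {z : ℂ} {r : ℝ} (hz : |z.im| ≤ 1 / r) :
    |((Real.pi : ℂ) * z).im| ≤ Real.pi / r := by
  rw [im_ofReal_mul, abs_mul, abs_of_pos Real.pi_pos, div_eq_mul_one_div]
  exact mul_le_mul_of_nonneg_left hz Real.pi_pos.le

lemma abs_im_pi_mul_mul_add_le {T : ℝ} {α : ℂ} (him : |T * α.im| ≤ 1 / 3) (x : ℝ) :
    |(Real.pi * T * (x + α)).im| ≤ Real.pi / 3 := by
  rw [mul_assoc]
  refine abs_im_pi_mul_le ?_
  rwa [im_ofReal_mul, add_im, ofReal_im, zero_add]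

lemma eventually_abs_mul_im_le (α : ℂ) : ∀ᶠ T : ℝ in 𝓝[>] 0, |T * α.im| ≤ 1 / 3 := by
  have hlim : Tendsto (fun T : ℝ => |T * α.im|) (𝓝[>] 0) (𝓝 0) :=
    Continuous.tendsto' (by fun_prop) 0 0 (by simp) |>.mono_left nhdsWithin_le_nhds
  exact hlim.eventually_le_const (by norm_num)

lemma exp_neg_mul_sq_mul_exp_norm_le {T : ℝ} (hT0 : 0 ≤ T) (hT1 : T ≤ 1) {M : ℝ} (hM : 0 ≤ M)
    (x : ℝ) (α : ℂ) :
    Real.exp (-(Real.pi * T) * x ^ 2) * Real.exp (M * ‖Real.pi * T * (x + α)‖) ≤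
      Real.exp (M * Real.pi * ‖α‖) *
        Real.exp (T * (-Real.pi * x ^ 2 + M * Real.pi * |x|)) := by
  rw [← Real.exp_add, ← Real.exp_add]
  refine Real.exp_le_exp.2 ?_
  calc _ ≤ -(Real.pi * T) * x ^ 2 + M * (Real.pi * T * (|x| + ‖α‖)) := by
        gcongr; exact norm_pi_mul_mul_add_le hT0 x α
    _ = T * (M * Real.pi * ‖α‖) + T * (-Real.pi * x ^ 2 + M * Real.pi * |x|) := by ring
    _ ≤ _ := add_le_add_left (mul_le_of_le_one_left (by positivity) hT1) _

lemma norm_unit_zpow_mul_gaussian_mul {ε : ℂ} (hε : ε ^ 2 = 1) (s : ℝ) (j : ℤ) (z : ℂ) :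
    ‖ε ^ j * ((Real.exp (-s * (j : ℝ) ^ 2) : ℂ) * z)‖ = Real.exp (-s * (j : ℝ) ^ 2) * ‖z‖ := by
  rw [norm_mul, norm_zpow, norm_eq_one_of_pow_eq_one hε two_ne_zero, one_zpow, one_mul, norm_mul,
    norm_real, Real.norm_eq_abs, Real.abs_exp]

lemma summable_unit_zpow_mul_gaussian_mul_inv_int_add {ε : ℂ} (hε : ε ^ 2 = 1) (α : ℂ) {s : ℝ}
    (hs : 0 < s) :
    Summable fun j : ℤ => ε ^ j * (Real.exp (-s * (j : ℝ) ^ 2) : ℂ) * ((j : ℂ) + α)⁻¹ := by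
  have hinv : (fun j : ℤ => ((j : ℂ) + α)⁻¹) =O[cofinite] fun _ => (1 : ℝ) := by
    have hlin := EisensteinSeries.linear_inv_isBigO_right 1 α
    simp only [Int.cast_one, one_mul] at hlin
    refine (hlin.congr_left fun j => by rw [add_comm]).trans (.of_bound 1 (.of_forall fun j => ?_))
    rcases eq_or_ne j 0 with rfl | hj
    · simp
    · have : (1 : ℝ) ≤ |(j : ℝ)| := by exact_mod_cast Int.one_le_abs hj
      simpa using inv_le_one_of_one_le₀ this
  have hgauss : (fun j : ℤ => ε ^ j * (Real.exp (-s * (j : ℝ) ^ 2) : ℂ)) =O[cofinite]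
      fun j : ℤ => Real.exp (-s * (j : ℝ) ^ 2) :=
    .of_bound 1 (.of_forall fun j => by
      have := norm_unit_zpow_mul_gaussian_mul hε s j 1
      rw [mul_one, norm_one, mul_one] at this
      rw [this, Real.norm_eq_abs, Real.abs_exp, one_mul])
  exact summable_of_isBigO (summable_exp_neg_mul_int_sq hs) (by simpa using hgauss.mul hinv)

lemma tendsto_tsum_unit_zpow_mul_gaussian_mul_inv_int_add {α ε : ℂ} (hα : α ∈ integerComplement)
    (hε : ε ^ 2 = 1) :
    Tendsto (fun T : ℝ => ∑' j : ℤ,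
        ε ^ j * (Real.exp (-(Real.pi * T) * (j : ℝ) ^ 2) : ℂ) * ((j : ℂ) + α)⁻¹) (𝓝[>] 0)
      (𝓝 (∑' j : ℤ, ε ^ j * (α / (α ^ 2 - (j : ℂ) ^ 2)))) := by
  have hterm : ∀ j : ℤ, Tendsto (fun T : ℝ => ε ^ j *
      (Real.exp (-(Real.pi * T) * (j : ℝ) ^ 2) : ℂ) * (α / (α ^ 2 - (j : ℂ) ^ 2))) (𝓝[>] 0)
      (𝓝 (ε ^ j * (α / (α ^ 2 - (j : ℂ) ^ 2)))) := fun j =>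
    Continuous.tendsto' (by fun_prop) 0 _ (by simp) |>.mono_left nhdsWithin_le_nhds
  refine (tendsto_tsum_of_dominated_convergence
    (hasSum_div_sq_sub_int_sq hα).summable.norm hterm ?_).congr' ?_
  · filter_upwards [self_mem_nhdsWithin] with T hT j
    have hT : 0 < T := hT
    rw [mul_assoc, norm_unit_zpow_mul_gaussian_mul hε]
    refine mul_le_of_le_one_left (norm_nonneg _) (Real.exp_le_one_iff.2 ?_)
    rw [neg_mul, neg_nonpos]
    positivity
  · filter_upwards [self_mem_nhdsWithin] with T hT
    have hT : 0 < T := hT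
    refine (tsum_mul_inv_int_add hα (fun j => ?_)
      (summable_unit_zpow_mul_gaussian_mul_inv_int_add hε α (by positivity))).symm
    have hεj : ε ^ (-j) = ε ^ j := by
      rw [zpow_neg, ← inv_zpow, inv_eq_of_mul_eq_one_right (by rw [← sq, hε])]
    rw [hεj, Int.cast_neg, neg_sq]

lemma norm_gaussian_mul_expDivSinh_sub_pole_le {ε : ℂ} (hε : ε ^ 2 = 1) (b : ℂ) {T : ℝ}
    (hT0 : 0 < T) (hT1 : T ≤ 1) (j : ℤ) {α : ℂ} (hw : |(Real.pi * T * (j + α)).im| ≤ Real.pi / 3) :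
    ‖(T : ℂ) * (ε ^ j * ((Real.exp (-(Real.pi * T) * (j : ℝ) ^ 2) : ℂ) *
        expDivSinh b (Real.pi * T * (j + α)))) - (2 * Real.pi : ℂ)⁻¹ *
        (ε ^ j * (Real.exp (-(Real.pi * T) * (j : ℝ) ^ 2) : ℂ) * ((j : ℂ) + α)⁻¹)‖ ≤
      Real.pi / 4 * (‖b‖ + 1) * Real.exp ((‖b‖ + 1) * Real.pi * ‖α‖) * T *
        Real.exp (T * (-Real.pi * (j : ℝ) ^ 2 + (‖b‖ + 1) * Real.pi * |(j : ℝ)|)) := by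
  have hT : (T : ℂ) * (T : ℂ)⁻¹ = 1 := mul_inv_cancel₀ (by exact_mod_cast hT0.ne')
  have hexp := exp_neg_mul_sq_mul_exp_norm_le hT0.le hT1 (M := ‖b‖ + 1) (by positivity) j α
  have hsinh := norm_expDivSinh_sub_inv_le b (hw.trans (by linarith [Real.pi_pos]))
  have hpole : (2 * Real.pi : ℂ)⁻¹ * ((j : ℂ) + α)⁻¹ = T * (2 * (Real.pi * T * (j + α)))⁻¹ := by
    simp only [mul_inv]
    linear_combination (-(2⁻¹ * (Real.pi : ℂ)⁻¹ * ((j : ℂ) + α)⁻¹)) * hT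
  rw [ofReal_intCast] at hexp
  set w : ℂ := Real.pi * T * (j + α)
  rw [mul_left_comm (2 * Real.pi : ℂ)⁻¹, hpole, ← mul_assoc (ε ^ j), mul_left_comm _ (T : ℂ),
    ← mul_sub, ← mul_sub, mul_assoc, norm_mul, norm_unit_zpow_mul_gaussian_mul hε,
    Complex.norm_of_nonneg hT0.le]
  calc _ ≤ T * (Real.exp (-(Real.pi * T) * (j : ℝ) ^ 2) *
          (Real.pi / 4 * (‖b‖ + 1) * Real.exp ((‖b‖ + 1) * ‖w‖))) := by gcongr
    _ = Real.pi / 4 * (‖b‖ + 1) * T *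
          (Real.exp (-(Real.pi * T) * (j : ℝ) ^ 2) * Real.exp ((‖b‖ + 1) * ‖w‖)) := by ring
    _ ≤ Real.pi / 4 * (‖b‖ + 1) * T * (Real.exp ((‖b‖ + 1) * Real.pi * ‖α‖) *
          Real.exp (T * (-Real.pi * (j : ℝ) ^ 2 + (‖b‖ + 1) * Real.pi * |(j : ℝ)|))) :=
        mul_le_mul_of_nonneg_left hexp (by positivity)
    _ = _ := by ring

theorem tendsto_mul_appellSum_expDivSinh {α ε : ℂ} (hα : α ∈ integerComplement) (hε : ε ^ 2 = 1)
    (b : ℂ) :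
    Tendsto (fun T : ℝ => (T : ℂ) * appellSum ε (expDivSinh b) α T) (𝓝[>] 0)
      (𝓝 ((2 * Real.pi : ℂ)⁻¹ * ∑' j : ℤ, ε ^ j * (α / (α ^ 2 - (j : ℂ) ^ 2)))) := by
  have hpole := (tendsto_tsum_unit_zpow_mul_gaussian_mul_inv_int_add hα hε).const_mul
    ((2 * Real.pi : ℂ)⁻¹)
  simp_rw [appellSum, ← tsum_mul_left] at hpole ⊢
  refine tendsto_tsum_of_norm_sub_le (δ := Real.pi) (K := (‖b‖ + 1) * Real.pi)
    (B := Real.pi / 4 * (‖b‖ + 1) * Real.exp ((‖b‖ + 1) * Real.pi * ‖α‖)) Real.pi_pos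
    (fun T hT => (summable_unit_zpow_mul_gaussian_mul_inv_int_add hε α
      (mul_pos Real.pi_pos hT)).mul_left _) hpole ?_
  filter_upwards [eventually_abs_mul_im_le α, Ioc_mem_nhdsGT one_pos] with T him hT j
  exact norm_gaussian_mul_expDivSinh_sub_pole_le hε b hT.1 hT.2 j
    (by simpa using abs_im_pi_mul_mul_add_le him j)

lemma sqrt_mul_norm_pi_mul_mul_add_le {T : ℝ} (hT0 : 0 ≤ T) (hT1 : T ≤ 1) (x : ℝ) (α : ℂ) :
    √T * ‖Real.pi * T * (x + α)‖ ≤ Real.pi * (1 + ‖α‖) * T * Real.exp (T * x ^ 2) := by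
  have hexp : 1 ≤ Real.exp (T * x ^ 2) := Real.one_le_exp (by positivity)
  have hx : √T * |x| ≤ Real.exp (T * x ^ 2) := by
    have hsq : (√T * |x|) ^ 2 = T * x ^ 2 := by rw [mul_pow, Real.sq_sqrt hT0, sq_abs]
    nlinarith [Real.add_one_le_exp (T * x ^ 2), sq_nonneg (√T * |x| - 1)]
  have hα : √T * ‖α‖ ≤ ‖α‖ * Real.exp (T * x ^ 2) := by
    rw [mul_comm]
    gcongr
    exact (Real.sqrt_le_one.2 hT1).trans hexp
  calc _ ≤ √T * (Real.pi * T * (|x| + ‖α‖)) := by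
        gcongr; exact norm_pi_mul_mul_add_le hT0 x α
    _ = Real.pi * T * (√T * |x| + √T * ‖α‖) := by ring
    _ ≤ Real.pi * T * (Real.exp (T * x ^ 2) + ‖α‖ * Real.exp (T * x ^ 2)) := by gcongr
    _ = _ := by ring

lemma norm_gaussian_mul_expDivCosh_sub_half_le (b : ℂ) {T : ℝ} (hT0 : 0 < T) (hT1 : T ≤ 1)
    (j : ℤ) {α : ℂ} (hw : |(Real.pi * T * (j + α)).im| ≤ Real.pi / 3) :
    ‖(√T : ℂ) * ((Real.exp (-(Real.pi * T) * (j : ℝ) ^ 2) : ℂ) *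
        expDivCosh b (Real.pi * T * (j + α))) -
        (√T : ℂ) * ((Real.exp (-(Real.pi * T) * (j : ℝ) ^ 2) : ℂ) * (1 / 2))‖ ≤
      (‖b‖ + 1) * (Real.pi * (1 + ‖α‖)) * Real.exp ((‖b‖ + 1) * Real.pi * ‖α‖) * T *
        Real.exp (T * (-(Real.pi - 1) * (j : ℝ) ^ 2 + (‖b‖ + 1) * Real.pi * |(j : ℝ)|)) := by
  have hsqrt := sqrt_mul_norm_pi_mul_mul_add_le hT0.le hT1 j α
  have hexp := exp_neg_mul_sq_mul_exp_norm_le hT0.le hT1 (M := ‖b‖ + 1) (by positivity) j α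
  have hcosh := norm_expDivCosh_sub_half_le b hw
  rw [ofReal_intCast] at hexp hsqrt
  set w : ℂ := Real.pi * T * (j + α)
  rw [← mul_sub, ← mul_sub, norm_mul, norm_mul, norm_real, norm_real,
    Real.norm_of_nonneg (Real.sqrt_nonneg T), Real.norm_eq_abs, Real.abs_exp]
  calc _ ≤ √T * (Real.exp (-(Real.pi * T) * (j : ℝ) ^ 2) *
          ((‖b‖ + 1) * ‖w‖ * Real.exp ((‖b‖ + 1) * ‖w‖))) := by gcongr
    _ = (‖b‖ + 1) * ((√T * ‖w‖) *
          (Real.exp (-(Real.pi * T) * (j : ℝ) ^ 2) * Real.exp ((‖b‖ + 1) * ‖w‖))) := by ring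
    _ ≤ (‖b‖ + 1) * ((Real.pi * (1 + ‖α‖) * T * Real.exp (T * (j : ℝ) ^ 2)) *
          (Real.exp ((‖b‖ + 1) * Real.pi * ‖α‖) *
            Real.exp (T * (-Real.pi * (j : ℝ) ^ 2 + (‖b‖ + 1) * Real.pi * |(j : ℝ)|)))) := by
        gcongr ?_ * ?_
        exact mul_le_mul hsqrt hexp (by positivity) (by positivity)
    _ = (‖b‖ + 1) * (Real.pi * (1 + ‖α‖)) * Real.exp ((‖b‖ + 1) * Real.pi * ‖α‖) * T *
          (Real.exp (T * (j : ℝ) ^ 2) *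
            Real.exp (T * (-Real.pi * (j : ℝ) ^ 2 + (‖b‖ + 1) * Real.pi * |(j : ℝ)|))) := by ring
    _ = _ := by
        rw [← Real.exp_add]
        ring_nf

theorem tendsto_sqrt_mul_appellSum_expDivCosh (b α : ℂ) :
    Tendsto (fun T : ℝ => (√T : ℂ) * appellSum 1 (expDivCosh b) α T) (𝓝[>] 0) (𝓝 (1 / 2)) := by
  have hgauss : Tendsto (fun T : ℝ => ∑' j : ℤ,
      (√T : ℂ) * ((Real.exp (-(Real.pi * T) * (j : ℝ) ^ 2) : ℂ) * (1 / 2))) (𝓝[>] 0)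
      (𝓝 (1 / 2)) := by
    have hreal := (tendsto_sqrt_mul_tsum_exp_neg_mul_int_sq Real.pi_pos).ofReal.mul_const
      (1 / 2 : ℂ)
    simp only [div_self Real.pi_ne_zero, Real.sqrt_one, ofReal_one, one_mul, ofReal_mul,
      ofReal_tsum, mul_assoc] at hreal
    simpa only [← tsum_mul_left, ← tsum_mul_right] using hreal
  simp_rw [appellSum, one_zpow, one_mul, ← tsum_mul_left]
  refine tendsto_tsum_of_norm_sub_le (δ := Real.pi - 1) (K := (‖b‖ + 1) * Real.pi)
    (B := (‖b‖ + 1) * (Real.pi * (1 + ‖α‖)) * Real.exp ((‖b‖ + 1) * Real.pi * ‖α‖))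
    (by linarith [Real.pi_gt_three]) (fun T hT => ?_) hgauss ?_
  · have hsum := ofRealCLM.summable (summable_exp_neg_mul_int_sq (mul_pos Real.pi_pos hT))
    exact (hsum.mul_right _).mul_left _
  filter_upwards [eventually_abs_mul_im_le α, Ioc_mem_nhdsGT one_pos] with T him hT j
  exact norm_gaussian_mul_expDivCosh_sub_half_le b hT.1 hT.2 j
    (by simpa using abs_im_pi_mul_mul_add_le him j)

/-! ### Shifting horizontal contours -/

lemma intervalIntegral_line_sub_line {H : ℂ → ℂ} {c d : ℝ}
    (hH : DifferentiableOn ℂ H {z | z.im ∈ Set.uIcc c d}) (R : ℝ) :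
    ∫ x in (-R)..R, (H (x + c * I) - H (x + d * I)) =
      I * (∫ y in c..d, H ((-R : ℝ) + y * I)) - I * (∫ y in c..d, H (R + y * I)) := by
  have hcont : ∀ s ∈ Set.uIcc c d, Continuous fun x : ℝ => H (x + s * I) := fun s hs =>
    hH.continuousOn.comp_continuous (by fun_prop) fun x => by simpa using hs
  have hrect := integral_boundary_rect_eq_zero_of_differentiableOn H ((-R : ℝ) + c * I) (R + d * I)
    (hH.mono fun z hz => by simpa using hz.2)
  simp only [add_re, add_im, ofReal_re, ofReal_im, mul_re, mul_im, I_re, I_im, mul_zero, mul_one,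
    sub_zero, add_zero, zero_add, smul_eq_mul] at hrect
  rw [intervalIntegral.integral_sub ((hcont c Set.left_mem_uIcc).intervalIntegrable _ _)
    ((hcont d Set.right_mem_uIcc).intervalIntegrable _ _)]
  linear_combination hrect

lemma tendsto_intervalIntegral_vertical {H : ℂ → ℂ} {c d : ℝ} {g : ℝ → ℝ}
    (hH : ∀ x y : ℝ, y ∈ Set.uIcc c d → ‖H (x + y * I)‖ ≤ g x) {l : Filter ℝ}
    (hg : Tendsto g l (𝓝 0)) :
    Tendsto (fun x : ℝ => ∫ y in c..d, H (x + y * I)) l (𝓝 0) := by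
  refine squeeze_zero_norm (fun x => intervalIntegral.norm_integral_le_of_norm_le_const
    fun y hy => hH x y (Set.uIoc_subset_uIcc hy)) ?_
  simpa using hg.mul_const |d - c|

lemma integral_line_sub_line_eq_zero {H : ℂ → ℂ} {c d : ℝ} {g : ℝ → ℝ}
    (hH : DifferentiableOn ℂ H {z | z.im ∈ Set.uIcc c d})
    (hHg : ∀ x y : ℝ, y ∈ Set.uIcc c d → ‖H (x + y * I)‖ ≤ g x)
    (hg : Tendsto g (cocompact ℝ) (𝓝 0))
    (hintegrable : Integrable fun x : ℝ => H (x + c * I) - H (x + d * I)) :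
    ∫ x : ℝ, (H (x + c * I) - H (x + d * I)) = 0 := by
  refine tendsto_nhds_unique
    (intervalIntegral_tendsto_integral hintegrable tendsto_neg_atTop_atBot tendsto_id) ?_
  have hright := tendsto_intervalIntegral_vertical hHg (hg.mono_left atTop_le_cocompact)
  have hleft := (tendsto_intervalIntegral_vertical hHg (hg.mono_left atBot_le_cocompact)).comp
    tendsto_neg_atTop_atBot
  simpa only [id, Function.comp_def, intervalIntegral_line_sub_line hH, mul_zero, sub_zero] using
    (hleft.const_mul I).sub (hright.const_mul I)

section Gaussian

variable {G : ℂ → ℂ} {c d C K s : ℝ}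

lemma norm_exp_neg_mul_sq_line (s x y : ℝ) :
    ‖exp (-s * (x + y * I) ^ 2)‖ = Real.exp (-s * x ^ 2 + s * y ^ 2) := by
  rw [norm_exp]
  congr 1
  simp only [sq, neg_mul, neg_re, mul_re, add_re, add_im, ofReal_re, ofReal_im,
    mul_im, I_re, I_im]
  ring

lemma norm_exp_neg_mul_sq_mul_le
    (hG : ∀ z : ℂ, z.im ∈ Set.uIcc c d → ‖G z‖ ≤ C * Real.exp (K * ‖z‖)) (hK : 0 ≤ K) (hs : 0 < s)
    (x : ℝ) {y : ℝ} (hy : y ∈ Set.uIcc c d) :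
    ‖exp (-s * (x + y * I) ^ 2) * G (x + y * I)‖ ≤
      C * Real.exp (s * (|c| + |d|) ^ 2 + K * (|c| + |d|) + K ^ 2 / (2 * s)) *
        Real.exp (-(s / 2) * x ^ 2) := by
  have hGz := hG (x + y * I) (by simpa using hy)
  have hC : 0 ≤ C := nonneg_of_mul_nonneg_left ((norm_nonneg _).trans hGz) (Real.exp_pos _)
  have hy_le : |y| ≤ |c| + |d| :=
    (abs_le_max_abs_abs hy.1 hy.2).trans <| (max_le abs_min_le_max_abs_abs
      abs_max_le_max_abs_abs).trans (max_le_add_of_nonneg (abs_nonneg c) (abs_nonneg d))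
  have hnorm : ‖(x + y * I : ℂ)‖ ≤ |x| + (|c| + |d|) := by
    refine (norm_add_le _ _).trans ?_
    simpa using hy_le
  have hsq : s * y ^ 2 ≤ s * (|c| + |d|) ^ 2 := by
    rw [← sq_abs y]
    gcongr
  have hKnorm := mul_le_mul_of_nonneg_left hnorm hK
  have hquad := neg_mul_sq_add_mul_abs_le hs K x
  calc _ ≤ Real.exp (-s * x ^ 2 + s * y ^ 2) * (C * Real.exp (K * ‖(x + y * I : ℂ)‖)) := by
        rw [norm_mul, norm_exp_neg_mul_sq_line]
        gcongr
    _ = C * Real.exp (-s * x ^ 2 + s * y ^ 2 + K * ‖(x + y * I : ℂ)‖) := by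
        rw [Real.exp_add _ (K * _)]; ring
    _ ≤ C * Real.exp (s * (|c| + |d|) ^ 2 + K * (|c| + |d|) + K ^ 2 / (2 * s) +
          -(s / 2) * x ^ 2) :=
        mul_le_mul_of_nonneg_left (Real.exp_le_exp.2 (by linarith)) hC
    _ = _ := by rw [Real.exp_add _ (-(s / 2) * _)]; ring

lemma integrable_exp_neg_mul_sq_mul_line (hGd : DifferentiableOn ℂ G {z | z.im ∈ Set.uIcc c d})
    (hG : ∀ z : ℂ, z.im ∈ Set.uIcc c d → ‖G z‖ ≤ C * Real.exp (K * ‖z‖)) (hK : 0 ≤ K) (hs : 0 < s)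
    {y : ℝ} (hy : y ∈ Set.uIcc c d) :
    Integrable fun x : ℝ => exp (-s * (x + y * I) ^ 2) * G (x + y * I) := by
  refine ((integrable_exp_neg_mul_sq (half_pos hs)).const_mul _).mono'
    (Continuous.aestronglyMeasurable ?_)
    (.of_forall fun x => norm_exp_neg_mul_sq_mul_le hG hK hs x hy)
  exact (by fun_prop : Continuous fun x : ℝ => exp (-s * (x + y * I) ^ 2)).mul
    (hGd.continuousOn.comp_continuous (by fun_prop) fun x => by simpa using hy)

theorem integral_exp_neg_mul_sq_mul_line_eq
    (hGd : DifferentiableOn ℂ G {z | z.im ∈ Set.uIcc c d})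
    (hG : ∀ z : ℂ, z.im ∈ Set.uIcc c d → ‖G z‖ ≤ C * Real.exp (K * ‖z‖)) (hK : 0 ≤ K)
    (hs : 0 < s) :
    ∫ x : ℝ, exp (-s * (x + c * I) ^ 2) * G (x + c * I) =
      ∫ x : ℝ, exp (-s * (x + d * I) ^ 2) * G (x + d * I) := by
  have hline : ∀ y ∈ Set.uIcc c d, _ := fun y hy =>
    integrable_exp_neg_mul_sq_mul_line hGd hG hK hs hy
  have hdecay : Tendsto (fun x : ℝ => C * Real.exp (s * (|c| + |d|) ^ 2 + K * (|c| + |d|) +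
      K ^ 2 / (2 * s)) * Real.exp (-(s / 2) * x ^ 2)) (cocompact ℝ) (𝓝 0) := by
    have := tendsto_rpow_abs_mul_exp_neg_mul_sq_cocompact (half_pos hs) 0
    simpa using this.const_mul (C * Real.exp (s * (|c| + |d|) ^ 2 + K * (|c| + |d|) +
      K ^ 2 / (2 * s)))
  rw [← sub_eq_zero, ← integral_sub (hline c Set.left_mem_uIcc) (hline d Set.right_mem_uIcc)]
  exact integral_line_sub_line_eq_zero (H := fun z => exp (-s * z ^ 2) * G z)
    ((by fun_prop : DifferentiableOn ℂ (fun z => exp (-s * z ^ 2)) _).mul hGd)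
    (fun x y hy => norm_exp_neg_mul_sq_mul_le hG hK hs x hy) hdecay
    ((hline c Set.left_mem_uIcc).sub (hline d Set.right_mem_uIcc))

lemma integrable_exp_neg_mul_sq_add_mul_abs (hs : 0 < s) (K : ℝ) :
    Integrable fun x : ℝ => Real.exp (-s * x ^ 2 + K * |x|) := by
  refine ((integrable_exp_neg_mul_sq (half_pos hs)).const_mul (Real.exp (K ^ 2 / (2 * s)))).mono'
    (by fun_prop) (.of_forall fun x => ?_)
  rw [Real.norm_eq_abs, Real.abs_exp, ← Real.exp_add]
  exact Real.exp_le_exp.2 ((neg_mul_sq_add_mul_abs_le hs K x).trans_eq (add_comm _ _))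

lemma norm_exp_neg_mul_sq_mul_line_inv_sqrt_le {x : ℝ} (hs : 1 ≤ s) (hK : 0 ≤ K)
    (hG : ‖G (x + (-(√s)⁻¹ : ℝ) * I)‖ ≤ C * Real.exp (K * ‖(x + (-(√s)⁻¹ : ℝ) * I : ℂ)‖)) :
    ‖exp (-s * (x + (-(√s)⁻¹ : ℝ) * I) ^ 2) * G (x + (-(√s)⁻¹ : ℝ) * I)‖ ≤
      C * Real.exp (1 + K) * Real.exp (-s * x ^ 2 + K * |x|) := by
  have hC : 0 ≤ C := nonneg_of_mul_nonneg_left ((norm_nonneg _).trans hG) (Real.exp_pos _)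
  have hheight : s * (-(√s)⁻¹) ^ 2 = 1 := by
    rw [neg_sq, inv_pow, Real.sq_sqrt (by linarith), mul_inv_cancel₀ (by linarith)]
  have hnorm : ‖(x + (-(√s)⁻¹ : ℝ) * I : ℂ)‖ ≤ |x| + 1 := by
    refine (norm_add_le _ _).trans (add_le_add (norm_real x).le ?_)
    rw [norm_mul, norm_I, mul_one, norm_real, norm_neg, Real.norm_of_nonneg (by positivity)]
    exact inv_le_one_of_one_le₀ (Real.one_le_sqrt.2 hs)
  calc _ ≤ Real.exp (-s * x ^ 2 + 1) * (C * Real.exp (K * (|x| + 1))) := by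
        rw [norm_mul, norm_exp_neg_mul_sq_line, hheight]
        gcongr
        exact hG.trans (by gcongr)
    _ = C * Real.exp (1 + K) * Real.exp (-s * x ^ 2 + K * |x|) := by
        rw [mul_assoc, ← Real.exp_add, mul_left_comm, ← Real.exp_add]
        ring_nf

lemma tendsto_exp_neg_mul_sq_add_atTop {x : ℝ} (hx : x ≠ 0) (y : ℝ) :
    Tendsto (fun s : ℝ => Real.exp (-s * x ^ 2 + y)) atTop (𝓝 0) :=
  Real.tendsto_exp_atBot.comp <| tendsto_atBot_add_const_right _ _ <|
    tendsto_neg_atTop_atBot.atBot_mul_const (by positivity)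

/- A bound that is uniform up to the real line lets the contour move to height `-1 / √s`, where
the Gaussian is still at most `e`; a singularity of `G` at `0` is therefore harmless. -/
theorem tendsto_integral_exp_neg_mul_sq_mul_line_atTop (hc : c < 0)
    (hGd : DifferentiableOn ℂ G {z | z.im ∈ Set.Ico c 0})
    (hG : ∀ z : ℂ, z.im ∈ Set.Ico c 0 → ‖G z‖ ≤ C * Real.exp (K * ‖z‖)) (hK : 0 ≤ K) :
    Tendsto (fun s : ℝ => ∫ x : ℝ, exp (-s * (x + c * I) ^ 2) * G (x + c * I)) atTop (𝓝 0) := by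
  set d : ℝ → ℝ := fun s => -(√s)⁻¹
  have hd : Tendsto d atTop (𝓝 0) := by
    simpa using (tendsto_inv_atTop_zero.comp Real.tendsto_sqrt_atTop).neg
  have hmem : ∀ᶠ s in atTop, 1 ≤ s ∧ d s ∈ Set.Ico c 0 := by
    filter_upwards [eventually_ge_atTop 1, hd.eventually_const_le hc] with s hs hcs
    exact ⟨hs, hcs, neg_neg_of_pos (by positivity)⟩
  have hsub : ∀ s, d s ∈ Set.Ico c 0 → Set.uIcc c (d s) ⊆ Set.Ico c 0 := fun s hs y hy => by
    rw [Set.uIcc_of_le hs.1] at hy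
    exact ⟨hy.1, hy.2.trans_lt hs.2⟩
  have hnorm : ∀ s, 1 ≤ s → d s ∈ Set.Ico c 0 → ∀ x : ℝ, _ := fun s hs hds x =>
    norm_exp_neg_mul_sq_mul_line_inv_sqrt_le hs hK (hG (x + d s * I) (by simpa using hds))
  have hzero : Tendsto (fun s => ∫ x : ℝ, exp (-s * (x + d s * I) ^ 2) * G (x + d s * I)) atTop
      (𝓝 (∫ _ : ℝ, 0)) := by
    refine tendsto_integral_filter_of_dominated_convergence
      (fun x => C * Real.exp (1 + K) * Real.exp (-1 * x ^ 2 + K * |x|)) ?_ ?_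
      ((integrable_exp_neg_mul_sq_add_mul_abs one_pos K).const_mul _) ?_
    · filter_upwards [hmem] with s ⟨hs, hds⟩
      exact (integrable_exp_neg_mul_sq_mul_line (hGd.mono fun z hz => hsub s hds hz)
        (fun z hz => hG z (hsub s hds hz)) hK (by linarith) Set.right_mem_uIcc).1
    · filter_upwards [hmem] with s ⟨hs, hds⟩
      refine .of_forall fun x => (hnorm s hs hds x).trans ?_
      have hC : 0 ≤ C := nonneg_of_mul_nonneg_left
        ((norm_nonneg _).trans (hG (d s * I) (by simpa using hds))) (Real.exp_pos _)
      gcongr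
    · filter_upwards [Measure.ae_ne volume 0] with x hx
      refine squeeze_zero_norm' (hmem.mono fun s hs => hnorm s hs.1 hs.2 x) ?_
      simpa using (tendsto_exp_neg_mul_sq_add_atTop hx (K * |x|)).const_mul (C * Real.exp (1 + K))
  rw [integral_zero] at hzero
  refine hzero.congr' ?_
  filter_upwards [hmem] with s ⟨hs, hds⟩
  exact (integral_exp_neg_mul_sq_mul_line_eq (hGd.mono fun z hz => hsub s hds hz)
    (fun z hz => hG z (hsub s hds hz)) hK (by linarith)).symm

end Gaussian

/-! ### Mordell integrals -/

lemma integral_exp_neg_mul_sq_mul_exp_line {s : ℝ} (hs : 0 < s) (c r : ℝ) :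
    ∫ x : ℝ, exp (-s * (x + c * I) ^ 2) * exp (-I * (x + c * I) * r) =
      ((√(Real.pi / s) * Real.exp (-(1 / (4 * s)) * r ^ 2) : ℝ) : ℂ) := by
  have hs' : (s : ℂ) ≠ 0 := by exact_mod_cast hs.ne'
  have hquad := integral_cexp_quadratic (b := -s) (by simpa using hs) (-(2 * s * c + r) * I)
    ((s : ℂ) * c ^ 2 + (c : ℂ) * r)
  have hsqrt : ((Real.pi : ℂ) / -(-s)) ^ (1 / 2 : ℂ) = (√(Real.pi / s) : ℝ) := by
    rw [neg_neg, Real.sqrt_eq_rpow, ofReal_cpow (by positivity)]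
    push_cast
    rfl
  have hexp : ((s : ℂ) * c ^ 2 + (c : ℂ) * r) - (-(2 * s * c + r) * I) ^ 2 / (4 * -s) =
      (-(1 / (4 * s)) * r ^ 2 : ℝ) := by
    rw [mul_pow, I_sq]
    push_cast
    field_simp
    ring
  rw [ofReal_mul, ofReal_exp, ← hexp, ← hsqrt, ← hquad]
  refine integral_congr_ae (.of_forall fun x => ?_)
  simp only [← exp_add]
  congr 1
  linear_combination (-s * c ^ 2 - c * r : ℂ) * I_sq

lemma integral_exp_neg_I_mul_line {c : ℝ} (hc : c < 0) (x : ℝ) :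
    ∫ r : ℝ in Set.Ioi 0, exp (-I * (x + c * I) * r) = -I * (x + c * I)⁻¹ := by
  have hre : (-I * (x + c * I)).re < 0 := by simpa using hc
  rw [integral_exp_mul_complex_Ioi hre, ofReal_zero, mul_zero, exp_zero]
  rw [neg_mul, neg_div_neg_eq, one_div, mul_inv, inv_I, neg_mul]

lemma integrable_exp_neg_mul_sq_mul_exp_line {s c : ℝ} (hs : 0 < s) (hc : c < 0) :
    Integrable (fun p : ℝ × ℝ => exp (-s * (p.1 + c * I) ^ 2) * exp (-I * (p.1 + c * I) * p.2))
      (volume.prod (volume.restrict (Set.Ioi 0))) := by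
  have hbound := ((integrable_exp_neg_mul_sq hs).const_mul (Real.exp (s * c ^ 2))).mul_prod
    (integrableOn_exp_mul_Ioi hc 0)
  refine hbound.mono' (Continuous.aestronglyMeasurable (by fun_prop)) (.of_forall fun p => ?_)
  rw [norm_mul, norm_exp_neg_mul_sq_line, norm_exp, ← Real.exp_add]
  simp [mul_comm, ← Real.exp_add, add_comm]

theorem integral_exp_neg_mul_sq_mul_inv_line {s c : ℝ} (hs : 0 < s) (hc : c < 0) :
    ∫ x : ℝ, exp (-s * (x + c * I) ^ 2) * (x + c * I)⁻¹ = Real.pi * I := by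
  have hinv : ∀ x : ℝ, exp (-s * (x + c * I) ^ 2) * (x + c * I)⁻¹ = I * ∫ r : ℝ in Set.Ioi 0,
      exp (-s * (x + c * I) ^ 2) * exp (-I * (x + c * I) * r) := fun x => by
    rw [integral_const_mul, integral_exp_neg_I_mul_line hc]
    linear_combination (exp (-s * (x + c * I) ^ 2) * (x + c * I)⁻¹) * I_sq
  simp_rw [hinv]
  rw [integral_const_mul, integral_integral_swap (integrable_exp_neg_mul_sq_mul_exp_line hs hc)]
  simp_rw [integral_exp_neg_mul_sq_mul_exp_line hs]
  rw [integral_complex_ofReal, integral_const_mul, integral_gaussian_Ioi, mul_div_assoc',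
    ← Real.sqrt_mul (by positivity)]
  have hsq : Real.pi / s * (Real.pi / (1 / (4 * s))) = (2 * Real.pi) ^ 2 := by
    field_simp
    ring
  rw [hsq, Real.sqrt_sq (by positivity)]
  push_cast
  ring

lemma integrable_exp_neg_mul_sq_mul_inv_line {s c : ℝ} (hs : 0 < s) (hc : c < 0) :
    Integrable fun x : ℝ => exp (-s * (x + c * I) ^ 2) * (x + c * I)⁻¹ :=
  .of_integral_ne_zero <| by
    rw [integral_exp_neg_mul_sq_mul_inv_line hs hc]
    exact mul_ne_zero (by exact_mod_cast Real.pi_ne_zero) I_ne_zero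

/-- The Mordell integral `∫ e ^ (-π t x² + 2π i t ξ x + β π x) / (2 cosh (π x)) dx`, which is, up to
elementary factors, the Fourier transform of the general term of `appellSum` for `expDivCosh`. -/
def mordell (β : ℂ) (t ξ : ℝ) : ℂ :=
  ∫ x : ℝ, exp (-(Real.pi * t : ℝ) * x ^ 2) *
    (exp (2 * Real.pi * I * t * ξ * x) * expDivCosh β (Real.pi * x))

lemma norm_exp_mul_expDivCosh_le (β ζ : ℂ) {z : ℂ} (hz : |z.im| ≤ 1 / 3) :
    ‖exp (ζ * z) * expDivCosh β (Real.pi * z)‖ ≤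
      1 * Real.exp ((‖ζ‖ + ‖β‖ * Real.pi) * ‖z‖) := by
  have hβ := norm_expDivCosh_le β (abs_im_pi_mul_le hz)
  rw [norm_mul, norm_mul, Complex.norm_of_nonneg Real.pi_pos.le] at hβ
  rw [norm_mul, one_mul, add_mul, Real.exp_add, ← norm_mul ζ, mul_assoc ‖β‖]
  exact mul_le_mul (norm_exp_le_exp_norm _) hβ (norm_nonneg _) (Real.exp_pos _).le

lemma differentiableAt_expDivCosh (β : ℂ) {w : ℂ} (hw : |w.im| ≤ Real.pi / 3) :
    DifferentiableAt ℂ (expDivCosh β) w := by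
  have hcosh : 2 * cosh w ≠ 0 := mul_ne_zero two_ne_zero (cosh_ne_zero_of_abs_im_le hw)
  unfold expDivCosh
  fun_prop (disch := exact hcosh)

lemma mordell_eq_integral_line (β : ℂ) {t : ℝ} (ht : 0 < t) (ξ : ℝ) {y : ℝ} (hy : |y| ≤ 1 / 3) :
    mordell β t ξ = ∫ x : ℝ, exp (-(Real.pi * t : ℝ) * (x + y * I) ^ 2) *
      (exp (2 * Real.pi * I * t * ξ * (x + y * I)) * expDivCosh β (Real.pi * (x + y * I))) := by
  have hstrip : ∀ z : ℂ, z.im ∈ Set.uIcc 0 y → |z.im| ≤ 1 / 3 := fun z hz =>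
    (by simpa using Set.abs_sub_left_of_mem_uIcc hz : |z.im| ≤ |y|).trans hy
  have hshift := integral_exp_neg_mul_sq_mul_line_eq (c := 0) (d := y)
    (G := fun z => exp (2 * Real.pi * I * t * ξ * z) * expDivCosh β (Real.pi * z))
    (fun z hz => DifferentiableAt.differentiableWithinAt <| by
      have hcosh := (differentiableAt_expDivCosh β (abs_im_pi_mul_le (hstrip z hz))).comp z
        (differentiableAt_id.const_mul _)
      exact (by fun_prop : DifferentiableAt ℂ _ z).mul hcosh)
    (fun z hz => norm_exp_mul_expDivCosh_le β _ (hstrip z hz)) (by positivity)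
    (s := Real.pi * t) (by positivity)
  simpa [mordell] using hshift

lemma expDivCosh_neg (β w : ℂ) : expDivCosh β (-w) = expDivCosh (-β) w := by
  simp [expDivCosh]

lemma mordell_neg (β : ℂ) (t ξ : ℝ) : mordell β t (-ξ) = mordell (-β) t ξ := by
  rw [mordell, ← integral_neg_eq_self, mordell]
  simp [expDivCosh_neg]

-- The weight `e ^ (π t / 4)` is the size of `e ^ (-π t x²)` at the poles `± i / 2`.
lemma norm_mordell_integrand_line_quarter_le (β : ℂ) {t ξ : ℝ} (ht : 1 ≤ t) (hξ : 5 / 4 ≤ ξ)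
    (x : ℝ) :
    Real.exp (Real.pi * t / 4) * ‖exp (-(Real.pi * t : ℝ) * (x + (1 / 4 : ℝ) * I) ^ 2) *
      (exp (2 * Real.pi * I * t * ξ * (x + (1 / 4 : ℝ) * I)) *
        expDivCosh β (Real.pi * (x + (1 / 4 : ℝ) * I)))‖ ≤
      Real.exp (‖β‖ * Real.pi / 4) * Real.exp (-Real.pi * x ^ 2 + ‖β‖ * Real.pi * |x|) *
        Real.exp (-(Real.pi * t * ξ / 4)) := by
  have hpi := Real.pi_pos
  have hosc : ‖exp (2 * Real.pi * I * t * ξ * (x + (1 / 4 : ℝ) * I))‖ =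
      Real.exp (-(Real.pi * t * ξ / 2)) := by
    rw [norm_exp]
    congr 1
    simp
    ring
  have hnorm : ‖β * (Real.pi * (x + (1 / 4 : ℝ) * I))‖ ≤ ‖β‖ * Real.pi * (|x| + 1 / 4) := by
    rw [norm_mul, norm_mul, Complex.norm_of_nonneg hpi.le, ← mul_assoc]
    gcongr
    refine (norm_add_le _ _).trans_eq ?_
    rw [norm_mul, norm_I, mul_one, norm_real, norm_real, Real.norm_eq_abs,
      Real.norm_of_nonneg (by norm_num)]
  have hcosh := (norm_expDivCosh_le β (abs_im_pi_mul_le (r := 3) (z := x + (1 / 4 : ℝ) * I)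
    (by norm_num [abs_of_pos]))).trans (Real.exp_le_exp.2 hnorm)
  have hsq : Real.pi * x ^ 2 ≤ Real.pi * t * x ^ 2 := by
    gcongr
    exact le_mul_of_one_le_right hpi.le ht
  have hlin : 0 ≤ Real.pi * t * (ξ - 5 / 4) := mul_nonneg (by positivity) (by linarith)
  rw [norm_mul, norm_mul, norm_exp_neg_mul_sq_line, hosc]
  calc _ ≤ Real.exp (Real.pi * t / 4) * (Real.exp (-(Real.pi * t) * x ^ 2 +
          Real.pi * t * (1 / 4) ^ 2) * (Real.exp (-(Real.pi * t * ξ / 2)) *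
          Real.exp (‖β‖ * Real.pi * (|x| + 1 / 4)))) := by gcongr
    _ ≤ _ := by
        simp only [← Real.exp_add]
        exact Real.exp_le_exp.2 (by linarith)

lemma exists_norm_mordell_le (β : ℂ) :
    ∃ C ≥ 0, ∀ t ξ : ℝ, 1 ≤ t → 5 / 4 ≤ ξ →
      Real.exp (Real.pi * t / 4) * ‖mordell β t ξ‖ ≤ C * Real.exp (-(Real.pi * t * ξ / 4)) := by
  refine ⟨∫ x : ℝ, Real.exp (‖β‖ * Real.pi / 4) *
    Real.exp (-Real.pi * x ^ 2 + ‖β‖ * Real.pi * |x|), integral_nonneg fun x => by positivity,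
    fun t ξ ht hξ => ?_⟩
  rw [mordell_eq_integral_line β (by linarith) ξ (y := 1 / 4) (by norm_num [abs_of_pos]),
    ← integral_mul_const, ← Complex.norm_of_nonneg (Real.exp_pos _).le, ← norm_mul,
    ← integral_const_mul]
  refine norm_integral_le_of_norm_le (((integrable_exp_neg_mul_sq_add_mul_abs Real.pi_pos
    _).const_mul _).mul_const _) (.of_forall fun x => ?_)
  rw [norm_mul, Complex.norm_of_nonneg (Real.exp_pos _).le]
  exact norm_mordell_integrand_line_quarter_le β ht hξ x

lemma cosh_eq_I_mul_sinh_sub (w : ℂ) : cosh w = I * sinh (w - Real.pi / 2 * I) := by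
  rw [Complex.sinh_sub, Complex.cosh_mul_I, Complex.sinh_mul_I, Complex.cos_pi_div_two,
    Complex.sin_pi_div_two]
  linear_combination cosh w * I_sq

lemma expDivCosh_eq_mul_expDivSinh (β w : ℂ) :
    expDivCosh β w = -I * exp (I * Real.pi * β / 2) * expDivSinh β (w - Real.pi / 2 * I) := by
  have hexp : exp (β * w) = exp (I * Real.pi * β / 2) * exp (β * (w - Real.pi / 2 * I)) := by
    rw [← exp_add]
    congr 1
    ring
  rw [expDivCosh, expDivSinh, cosh_eq_I_mul_sinh_sub, hexp, mul_left_comm 2 I, ← div_div,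
    div_eq_mul_inv _ I, inv_I]
  ring

lemma differentiableAt_expDivSinh (β : ℂ) {w : ℂ} (hw : |w.im| ≤ Real.pi / 2) (h0 : w ≠ 0) :
    DifferentiableAt ℂ (expDivSinh β) w := by
  have hsinh : 2 * sinh w ≠ 0 := mul_ne_zero two_ne_zero (sinh_ne_zero_of_abs_im_le hw h0)
  unfold expDivSinh
  fun_prop (disch := exact hsinh)

lemma exp_mul_mordell_half (β : ℂ) (t : ℝ) :
    (Real.exp (Real.pi * t / 4) : ℂ) * mordell β t (1 / 2) = -I * exp (I * Real.pi * β / 2) *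
      ∫ x : ℝ, exp (-(Real.pi * t : ℝ) * (x + (-(1 / 2) : ℝ) * I) ^ 2) *
        expDivSinh β (Real.pi * (x + (-(1 / 2) : ℝ) * I)) := by
  rw [mordell, ← integral_const_mul, ← integral_const_mul]
  refine integral_congr_ae (.of_forall fun x => ?_)
  have hquad : (Real.exp (Real.pi * t / 4) : ℂ) * (exp (-(Real.pi * t : ℝ) * x ^ 2) *
      exp (2 * Real.pi * I * t * (1 / 2 : ℝ) * x)) =
      exp (-(Real.pi * t : ℝ) * (x + (-(1 / 2) : ℝ) * I) ^ 2) := by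
    rw [ofReal_exp, ← exp_add, ← exp_add]
    congr 1
    push_cast
    linear_combination (Real.pi * t / 4 : ℂ) * I_sq
  have hshift : (Real.pi * x - Real.pi / 2 * I : ℂ) = Real.pi * (x + (-(1 / 2) : ℝ) * I) := by
    push_cast
    ring
  simp only [expDivCosh_eq_mul_expDivSinh, hshift, ← hquad]
  ring

lemma differentiableOn_expDivSinh_sub_inv (β : ℂ) :
    DifferentiableOn ℂ (fun z => expDivSinh β (Real.pi * z) - (2 * (Real.pi * z))⁻¹)
      {z | z.im ∈ Set.Ico (-(1 / 2)) 0} := fun z hz => by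
  have hz0 : Real.pi * z ≠ 0 :=
    mul_ne_zero (by exact_mod_cast Real.pi_ne_zero) fun h => by simp [h] at hz
  have hsinh := (differentiableAt_expDivSinh β
    (abs_im_pi_mul_le (abs_le.2 ⟨hz.1, hz.2.le.trans (by norm_num)⟩)) hz0).comp z
    (differentiableAt_id.const_mul _)
  have hinv : DifferentiableAt ℂ (fun z : ℂ => (2 * (Real.pi * z))⁻¹) z := by
    fun_prop (disch := exact mul_ne_zero two_ne_zero hz0)
  exact (hsinh.sub hinv).differentiableWithinAt

lemma norm_expDivSinh_pi_mul_sub_inv_le (β : ℂ) {z : ℂ} (hz : |z.im| ≤ 1 / 2) :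
    ‖expDivSinh β (Real.pi * z) - (2 * (Real.pi * z))⁻¹‖ ≤
      Real.pi / 4 * (‖β‖ + 1) * Real.exp ((‖β‖ + 1) * Real.pi * ‖z‖) := by
  have hsinh := norm_expDivSinh_sub_inv_le β (abs_im_pi_mul_le hz)
  rwa [norm_mul, Complex.norm_of_nonneg Real.pi_pos.le, ← mul_assoc (‖β‖ + 1)] at hsinh

lemma tendsto_integral_exp_neg_mul_sq_mul_expDivSinh (β : ℂ) :
    Tendsto (fun s : ℝ => ∫ x : ℝ, exp (-s * (x + (-(1 / 2) : ℝ) * I) ^ 2) *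
      expDivSinh β (Real.pi * (x + (-(1 / 2) : ℝ) * I))) atTop (𝓝 (I / 2)) := by
  have hdiff := differentiableOn_expDivSinh_sub_inv β
  have hbound : ∀ z : ℂ, z.im ∈ Set.Ico (-(1 / 2) : ℝ) 0 → _ := fun z hz =>
    norm_expDivSinh_pi_mul_sub_inv_le β (abs_le.2 ⟨hz.1, hz.2.le.trans (by norm_num)⟩)
  have hK : 0 ≤ (‖β‖ + 1) * Real.pi := by positivity
  have hhalf : (-(1 / 2) : ℝ) < 0 := by norm_num
  have hrem := tendsto_integral_exp_neg_mul_sq_mul_line_atTop hhalf hdiff hbound hK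
  rw [← zero_add (I / 2)]
  refine (hrem.add_const (I / 2)).congr' ?_
  filter_upwards [eventually_gt_atTop 0] with s hs
  have hline : ∀ z : ℂ, z.im ∈ Set.uIcc (-(1 / 2) : ℝ) (-(1 / 2)) →
      z.im ∈ Set.Ico (-(1 / 2) : ℝ) 0 := fun z hz => by
    rw [Set.uIcc_self, Set.mem_singleton_iff] at hz
    rw [hz]
    exact ⟨le_rfl, hhalf⟩
  have hrem_int := integrable_exp_neg_mul_sq_mul_line (hdiff.mono fun z hz => hline z hz)
    (fun z hz => hbound z (hline z hz)) hK hs Set.left_mem_uIcc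
  have hhalf_I : I / 2 = (2 * Real.pi : ℂ)⁻¹ * (Real.pi * I) := by
    field_simp
  rw [hhalf_I, ← integral_exp_neg_mul_sq_mul_inv_line hs hhalf, ← integral_const_mul,
    ← integral_add hrem_int ((integrable_exp_neg_mul_sq_mul_inv_line hs hhalf).const_mul _)]
  refine integral_congr_ae (.of_forall fun x => ?_)
  simp only [mul_inv]
  ring

theorem tendsto_exp_mul_mordell_half (β : ℂ) :
    Tendsto (fun t : ℝ => (Real.exp (Real.pi * t / 4) : ℂ) * mordell β t (1 / 2)) atTop
      (𝓝 (exp (I * Real.pi * β / 2) / 2)) := by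
  have hlim := ((tendsto_integral_exp_neg_mul_sq_mul_expDivSinh β).comp
    (tendsto_id.const_mul_atTop Real.pi_pos)).const_mul (-I * exp (I * Real.pi * β / 2))
  have hval : -I * exp (I * Real.pi * β / 2) * (I / 2) = exp (I * Real.pi * β / 2) / 2 := by
    linear_combination (-(exp (I * Real.pi * β / 2) / 2)) * I_sq
  rw [hval] at hlim
  exact hlim.congr fun t => (exp_mul_mordell_half β t).symm

/-! ### Alternating sums by Poisson summation -/

/-- The general term of `appellSum (-1) (expDivCosh b) α T` as a function of a real variable, with
`(-1) ^ j` interpolated by `e ^ (π i x)`. -/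
def appellTerm (b α : ℂ) (T x : ℝ) : ℂ :=
  exp (Real.pi * I * x) *
    ((Real.exp (-(Real.pi * T) * x ^ 2) : ℂ) * expDivCosh b (Real.pi * T * (x + α)))

lemma appellSum_neg_one_expDivCosh_eq_tsum_appellTerm (b α : ℂ) (T : ℝ) :
    appellSum (-1) (expDivCosh b) α T = ∑' j : ℤ, appellTerm b α T j := by
  refine tsum_congr fun j => ?_
  rw [appellTerm, ofReal_intCast, mul_comm (Real.pi * I), exp_int_mul, exp_pi_mul_I]

lemma continuous_appellTerm (b : ℂ) {α : ℂ} {T : ℝ} (him : |T * α.im| ≤ 1 / 3) :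
    Continuous (appellTerm b α T) := by
  have hcosh : Continuous fun x : ℝ => expDivCosh b (Real.pi * T * (x + α)) :=
    continuous_iff_continuousAt.2 fun x =>
      (differentiableAt_expDivCosh b (abs_im_pi_mul_mul_add_le him x)).continuousAt.comp
        (f := fun x : ℝ => (Real.pi * T * (x + α) : ℂ)) (by fun_prop)
  unfold appellTerm
  fun_prop

lemma appellTerm_eq_exp_quadratic_mul (b α : ℂ) (T x : ℝ) :
    appellTerm b α T x =
      exp (-(Real.pi * T) * x ^ 2 + (Real.pi * I + b * (Real.pi * T)) * x) *
        (exp (b * (Real.pi * T * α)) * expDivCosh 0 (Real.pi * T * (x + α))) := by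
  have hexp : exp (b * (Real.pi * T * (x + α))) =
      exp (b * (Real.pi * T) * x) * exp (b * (Real.pi * T * α)) := by
    rw [← exp_add]
    ring_nf
  rw [appellTerm, expDivCosh, expDivCosh, hexp, zero_mul, exp_zero, exp_add, add_mul, exp_add,
    ofReal_exp]
  push_cast
  ring

lemma appellTerm_isBigO_cocompact (b : ℂ) {α : ℂ} {T : ℝ} (hT : 0 < T)
    (him : |T * α.im| ≤ 1 / 3) :
    appellTerm b α T =O[cocompact ℝ] fun x : ℝ => |x| ^ (-2 : ℝ) := by
  have hgauss := (cexp_neg_quadratic_isLittleO_abs_rpow_cocompact (a := -(Real.pi * T))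
    (by simpa [← ofReal_mul] using mul_pos Real.pi_pos hT)
    (Real.pi * I + b * (Real.pi * T)) (-2)).isBigO
  have hcosh : (fun x : ℝ => expDivCosh 0 (Real.pi * T * (x + α))) =O[cocompact ℝ]
      fun _ => (1 : ℝ) := .of_bound 1 <| .of_forall fun x => by
    simpa using norm_expDivCosh_le 0 (abs_im_pi_mul_mul_add_le him x)
  simpa only [mul_one, ← appellTerm_eq_exp_quadratic_mul] using
    hgauss.mul (hcosh.const_mul_left (exp (b * (Real.pi * T * α))))

lemma exp_mul_appellTerm_eq (b α : ℂ) {T : ℝ} (hT : T ≠ 0) (ξ x : ℝ) :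
    exp (2 * Real.pi * I * (ξ - 1 / 2) * x) * appellTerm b α T x =
      exp (-(Real.pi * T * α ^ 2)) * exp (-(2 * Real.pi * I * ξ * α)) *
        (exp (-(Real.pi * T⁻¹ : ℝ) * (T * (x + α)) ^ 2) *
          (exp (2 * Real.pi * I * (T⁻¹ : ℝ) * ξ * (T * (x + α))) *
            expDivCosh (b + 2 * α) (Real.pi * (T * (x + α))))) := by
  have hT' : (T : ℂ) ≠ 0 := by exact_mod_cast hT
  simp only [appellTerm, expDivCosh, ofReal_exp, mul_div_assoc', ← exp_add, ← mul_assoc]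
  congr 2
  push_cast
  field_simp
  ring

lemma fourier_appellTerm (b : ℂ) {α : ℂ} {T : ℝ} (hT : 0 < T) (him : |T * α.im| ≤ 1 / 3) (n : ℤ) :
    𝓕 (appellTerm b α T) n = (T : ℂ)⁻¹ * (exp (-(Real.pi * T * α ^ 2)) *
      exp (-(2 * Real.pi * I * (1 / 2 - n : ℝ) * α)) * mordell (b + 2 * α) T⁻¹ (1 / 2 - n)) := by
  set F : ℝ → ℂ := fun v => exp (-(Real.pi * T⁻¹ : ℝ) * (v + (T * α.im : ℝ) * I) ^ 2) *
    (exp (2 * Real.pi * I * (T⁻¹ : ℝ) * (1 / 2 - n : ℝ) * (v + (T * α.im : ℝ) * I)) *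
      expDivCosh (b + 2 * α) (Real.pi * (v + (T * α.im : ℝ) * I))) with hF
  have hline : ∀ x : ℝ, (T : ℂ) * (x + α) = (T * x + T * α.re : ℝ) + (T * α.im : ℝ) * I := by
    intro x
    conv_lhs => rw [← re_add_im α]
    push_cast
    ring
  have hterm : ∀ x : ℝ, exp ((-2 * Real.pi * x * n : ℝ) * I) • appellTerm b α T x =
      exp (-(Real.pi * T * α ^ 2)) * exp (-(2 * Real.pi * I * (1 / 2 - n : ℝ) * α)) *
        F (T * x + T * α.re) := by
    intro x
    simp only [hF, ← hline]
    rw [← exp_mul_appellTerm_eq b α hT.ne', smul_eq_mul]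
    congr 2
    push_cast
    ring
  rw [Real.fourier_real_eq_integral_exp_smul]
  simp_rw [hterm]
  rw [integral_const_mul, Measure.integral_comp_mul_left (fun x => F (x + T * α.re)) T,
    integral_add_right_eq_self F, abs_of_pos (inv_pos.2 hT), hF,
    ← mordell_eq_integral_line (b + 2 * α) (inv_pos.2 hT) _ him, real_smul, ofReal_inv]
  ring

/-- The terms of the series dual to `appellSum (-1) (expDivCosh b) α T` under Poisson summation, at
`t = 1 / T` and the frequency `n = 1 / 2 - ξ`, scaled by `e ^ (π t / 4)` so that those with
`ξ = ± 1 / 2` have a nonzero limit as `t → ∞`. -/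
def dualTerm (b α : ℂ) (t ξ : ℝ) : ℂ :=
  (Real.exp (Real.pi * t / 4) : ℂ) * (exp (-(2 * Real.pi * I * ξ * α)) * mordell (b + 2 * α) t ξ)

theorem mul_appellSum_neg_one_expDivCosh_eq_tsum_dualTerm (b : ℂ) {α : ℂ} {T : ℝ} (hT : 0 < T)
    (him : |T * α.im| ≤ 1 / 3) (hsum : Summable fun n : ℤ => dualTerm b α T⁻¹ (1 / 2 - n)) :
    (T : ℂ) * (Real.exp (Real.pi * T⁻¹ / 4) : ℂ) * appellSum (-1) (expDivCosh b) α T =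
      exp (-(Real.pi * T * α ^ 2)) * ∑' n : ℤ, dualTerm b α T⁻¹ (1 / 2 - n) := by
  have hT0 : (T : ℂ) ≠ 0 := by exact_mod_cast hT.ne'
  have hfourier : ∀ n : ℤ, 𝓕 (appellTerm b α T) n = ((T : ℂ)⁻¹ *
      (Real.exp (Real.pi * T⁻¹ / 4) : ℂ)⁻¹ * exp (-(Real.pi * T * α ^ 2))) *
        dualTerm b α T⁻¹ (1 / 2 - n) := by
    intro n
    rw [fourier_appellTerm b hT him, dualTerm]
    field_simp
  have hpoisson := Real.tsum_eq_tsum_fourier_of_rpow_decay_of_summable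
    (continuous_appellTerm b him) one_lt_two (appellTerm_isBigO_cocompact b hT him)
    ((hsum.mul_left _).congr fun n => (hfourier n).symm) 0
  simp only [zero_add, hfourier, QuotientAddGroup.mk_zero, fourier_eval_zero, mul_one] at hpoisson
  rw [appellSum_neg_one_expDivCosh_eq_tsum_appellTerm, hpoisson, tsum_mul_left]
  field_simp

lemma tendsto_tsum_of_dominated_convergence_off_finset {ι κ E : Type*} {l : Filter ι}
    [NormedAddCommGroup E] [CompleteSpace E] {f : ι → κ → E} {g : κ → E} {bound : κ → ℝ}
    (s : Finset κ) (hbound : Summable bound) (hlim : ∀ k, Tendsto (f · k) l (𝓝 (g k)))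
    (hle : ∀ᶠ i in l, ∀ k ∉ s, ‖f i k‖ ≤ bound k) :
    Tendsto (fun i => ∑' k, f i k) l (𝓝 (∑' k, g k)) := by
  classical
  have hfinset : ∀ᶠ i in l, ∀ k ∈ s, ‖f i k‖ ≤ ‖g k‖ + 1 := (eventually_all_finset s).2 fun k _ =>
    (hlim k).norm.eventually_le_const (lt_add_one _)
  refine tendsto_tsum_of_dominated_convergence
    (bound := fun k => if k ∈ s then ‖g k‖ + 1 else bound k)
    (hbound.congr_cofinite ?_) hlim ?_
  · filter_upwards [s.eventually_cofinite_notMem] with k hk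
    rw [if_neg hk]
  · filter_upwards [hle, hfinset] with i hi hs k
    split_ifs with hk
    exacts [hs k hk, hi k hk]

lemma summable_exp_neg_pi_mul_abs_half_sub_int :
    Summable fun n : ℤ => Real.exp (-(Real.pi * |(1 / 2 - n : ℝ)|)) := by
  have hnat : Summable fun n : ℕ => Real.exp (n * -Real.pi) :=
    Real.summable_exp_nat_mul_iff.2 (neg_lt_zero.2 Real.pi_pos)
  have hexp : Summable fun n : ℤ => Real.exp (-(Real.pi * |(n : ℝ)|)) :=
    .of_nat_of_neg (hnat.congr fun n => by simp [mul_comm]) (hnat.congr fun n => by simp [mul_comm])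
  refine .of_nonneg_of_le (fun _ => (Real.exp_pos _).le) (fun n => ?_)
    (hexp.mul_left (Real.exp (Real.pi / 2)))
  have habs : |(n : ℝ)| ≤ 1 / 2 + |(1 / 2 - n : ℝ)| := by
    simpa [abs_of_pos] using abs_sub (1 / 2 : ℝ) (1 / 2 - n)
  rw [← Real.exp_add]
  refine Real.exp_le_exp.2 ?_
  linarith [mul_le_mul_of_nonneg_left habs Real.pi_pos.le]

lemma exists_norm_mordell_le_abs (β : ℂ) :
    ∃ C ≥ 0, ∀ t ξ : ℝ, 1 ≤ t → 5 / 4 ≤ |ξ| →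
      Real.exp (Real.pi * t / 4) * ‖mordell β t ξ‖ ≤ C * Real.exp (-(Real.pi * t * |ξ| / 4)) := by
  obtain ⟨C, hC0, hC⟩ := exists_norm_mordell_le β
  obtain ⟨C', -, hC'⟩ := exists_norm_mordell_le (-β)
  refine ⟨max C C', le_max_of_le_left hC0, fun t ξ ht hξ => ?_⟩
  rcases abs_cases ξ with ⟨habs, -⟩ | ⟨habs, -⟩ <;> rw [habs] at hξ ⊢
  · exact (hC t ξ ht hξ).trans (by gcongr; exact le_max_left _ _)
  · rw [← neg_neg ξ, mordell_neg, neg_neg]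
    exact (hC' t (-ξ) ht hξ).trans (by gcongr; exact le_max_right _ _)

lemma exists_norm_dualTerm_le (b α : ℂ) :
    ∃ C ≥ 0, ∀ t ξ : ℝ, 1 ≤ t → 5 / 4 ≤ |ξ| →
      ‖dualTerm b α t ξ‖ ≤ C * Real.exp (-(Real.pi * |ξ| * (t / 4 - 2 * ‖α‖))) := by
  obtain ⟨C, hC0, hC⟩ := exists_norm_mordell_le_abs (b + 2 * α)
  refine ⟨C, hC0, fun t ξ ht hξ => ?_⟩
  have hosc : ‖exp (-(2 * Real.pi * I * ξ * α))‖ ≤ Real.exp (2 * Real.pi * |ξ| * ‖α‖) := by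
    refine (norm_exp_le_exp_norm _).trans_eq ?_
    simp [abs_of_pos Real.pi_pos]
  rw [dualTerm, norm_mul, norm_mul, Complex.norm_of_nonneg (Real.exp_pos _).le, mul_left_comm]
  calc _ ≤ Real.exp (2 * Real.pi * |ξ| * ‖α‖) * (C * Real.exp (-(Real.pi * t * |ξ| / 4))) :=
        mul_le_mul hosc (hC t ξ ht hξ) (by positivity) (Real.exp_pos _).le
    _ = C * Real.exp (-(Real.pi * |ξ| * (t / 4 - 2 * ‖α‖))) := by
        rw [mul_left_comm, ← Real.exp_add]
        ring_nf

lemma five_quarters_le_abs_half_sub_int {n : ℤ} (hn : n ∉ ({0, 1} : Finset ℤ)) :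
    5 / 4 ≤ |(1 / 2 - n : ℝ)| := by
  simp only [Finset.mem_insert, Finset.mem_singleton, not_or] at hn
  rcases (by lia : n ≤ -1 ∨ 2 ≤ n) with hneg | hpos
  · have hneg : (n : ℝ) ≤ -1 := by exact_mod_cast hneg
    exact le_abs.2 (.inl (by linarith))
  · have hpos : (2 : ℝ) ≤ n := by exact_mod_cast hpos
    exact le_abs.2 (.inr (by linarith))

lemma tendsto_dualTerm_zero (b α : ℂ) {ξ : ℝ} (hξ : 5 / 4 ≤ |ξ|) :
    Tendsto (fun t => dualTerm b α t ξ) atTop (𝓝 0) := by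
  obtain ⟨C, -, hC⟩ := exists_norm_dualTerm_le b α
  have hlin : Tendsto (fun t : ℝ => Real.pi * |ξ| * (t / 4 - 2 * ‖α‖)) atTop atTop :=
    (tendsto_atTop_add_const_right _ _ (tendsto_id.atTop_div_const (by norm_num))).const_mul_atTop
      (mul_pos Real.pi_pos (by linarith))
  have hexp := (Real.tendsto_exp_neg_atTop_nhds_zero.comp hlin).const_mul C
  rw [mul_zero] at hexp
  refine squeeze_zero_norm' ?_ hexp
  filter_upwards [eventually_ge_atTop 1] with t ht using hC t ξ ht hξ

lemma tendsto_dualTerm_half (b α : ℂ) :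
    Tendsto (fun t => dualTerm b α t (1 / 2)) atTop (𝓝 (exp (I * Real.pi * b / 2) / 2)) := by
  have hlim := (tendsto_exp_mul_mordell_half (b + 2 * α)).const_mul
    (exp (-(2 * Real.pi * I * (1 / 2 : ℝ) * α)))
  rw [← mul_div_assoc, ← exp_add] at hlim
  convert hlim using 2 with t
  · rw [dualTerm, mul_left_comm]
  · congr 2
    push_cast
    ring

lemma dualTerm_neg (b α : ℂ) (t ξ : ℝ) : dualTerm b α t (-ξ) = dualTerm (-b) (-α) t ξ := by
  rw [dualTerm, dualTerm, mordell_neg, neg_add, mul_neg 2 α]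
  push_cast
  ring_nf

/-- The limit, as `t → ∞`, of the dual term at the frequency `n`. -/
def dualLimit (b : ℂ) (n : ℤ) : ℂ :=
  if n = 0 then exp (I * Real.pi * b / 2) / 2 else
    if n = 1 then exp (I * Real.pi * -b / 2) / 2 else 0

lemma tendsto_dualTerm (b α : ℂ) (n : ℤ) :
    Tendsto (fun t => dualTerm b α t (1 / 2 - n)) atTop (𝓝 (dualLimit b n)) := by
  unfold dualLimit
  split_ifs with h0 h1
  · simpa [h0] using tendsto_dualTerm_half b α
  · have hhalf : (1 / 2 - (n : ℝ)) = -(1 / 2) := by norm_num [h1]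
    simpa only [hhalf, dualTerm_neg] using tendsto_dualTerm_half (-b) (-α)
  · exact tendsto_dualTerm_zero b α (five_quarters_le_abs_half_sub_int (by simp [h0, h1]))

lemma tsum_dualLimit (b : ℂ) : ∑' n : ℤ, dualLimit b n = cos (Real.pi * b / 2) := by
  rw [tsum_eq_sum (s := {0, 1}) fun n hn => by
    simp only [Finset.mem_insert, Finset.mem_singleton, not_or] at hn
    simp [dualLimit, hn], Finset.sum_pair zero_ne_one, dualLimit, dualLimit, if_pos rfl,
    if_neg one_ne_zero, if_pos rfl, Complex.cos]
  ring_nf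

lemma exists_eventually_norm_dualTerm_le (b α : ℂ) :
    ∃ C : ℝ, ∀ᶠ t in atTop, ∀ n ∉ ({0, 1} : Finset ℤ),
      ‖dualTerm b α t (1 / 2 - n)‖ ≤ C * Real.exp (-(Real.pi * |(1 / 2 - n : ℝ)|)) := by
  obtain ⟨C, hC0, hC⟩ := exists_norm_dualTerm_le b α
  refine ⟨C, ?_⟩
  filter_upwards [eventually_ge_atTop 1, eventually_ge_atTop (4 * (1 + 2 * ‖α‖))] with t ht htα n hn
  refine (hC t _ ht (five_quarters_le_abs_half_sub_int hn)).trans ?_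
  refine mul_le_mul_of_nonneg_left (Real.exp_le_exp.2 (neg_le_neg ?_)) hC0
  exact le_mul_of_one_le_right (by positivity) (by linarith)

theorem tendsto_mul_exp_mul_appellSum_neg_one_expDivCosh (b α : ℂ) :
    Tendsto (fun T : ℝ => (T : ℂ) * (Real.exp (Real.pi * T⁻¹ / 4) : ℂ) *
      appellSum (-1) (expDivCosh b) α T) (𝓝[>] 0) (𝓝 (cos (Real.pi * b / 2))) := by
  obtain ⟨C, hC⟩ := exists_eventually_norm_dualTerm_le b α
  have hbound := summable_exp_neg_pi_mul_abs_half_sub_int.mul_left C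
  have hdual := tendsto_tsum_of_dominated_convergence_off_finset {0, 1} hbound
    (tendsto_dualTerm b α) hC
  have hprefactor : Tendsto (fun T : ℝ => exp (-(Real.pi * T * α ^ 2))) (𝓝[>] 0) (𝓝 1) :=
    Continuous.tendsto' (by fun_prop) 0 1 (by simp) |>.mono_left nhdsWithin_le_nhds
  have hlim := hprefactor.mul (hdual.comp tendsto_inv_nhdsGT_zero)
  rw [one_mul, tsum_dualLimit] at hlim
  refine hlim.congr' ?_
  filter_upwards [self_mem_nhdsWithin, eventually_abs_mul_im_le α,
    tendsto_inv_nhdsGT_zero.eventually hC] with T hT him hCT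
  refine (mul_appellSum_neg_one_expDivCosh_eq_tsum_dualTerm b hT him ?_).symm
  refine .of_norm_bounded_eventually hbound ?_
  filter_upwards [({0, 1} : Finset ℤ).eventually_cofinite_notMem] with n hn using hCT n hn

/-! ### The twelve functions at `τ = i T`, `z = a τ` -/

lemma e_mul_qPow (T : ℝ) (a x y : ℂ) :
    e (x * (a * (I * T))) * qPow (I * T) y = exp (-2 * (Real.pi * T * (x * a + y))) := by
  rw [e, qPow, ← Complex.exp_add]
  congr 1
  linear_combination (2 * Real.pi * T * (x * a + y)) * I_sq

lemma one_sub_exp_neg_two_mul (w : ℂ) : 1 - exp (-2 * w) = exp (-w) * (2 * sinh w) := by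
  rw [Complex.sinh, mul_div_cancel₀ _ two_ne_zero, mul_sub, ← Complex.exp_add, ← Complex.exp_add,
    neg_add_cancel, Complex.exp_zero, ← neg_add, ← two_mul, neg_mul]

lemma one_add_exp_neg_two_mul (w : ℂ) : 1 + exp (-2 * w) = exp (-w) * (2 * cosh w) := by
  rw [Complex.cosh, mul_div_cancel₀ _ two_ne_zero, mul_add, ← Complex.exp_add, ← Complex.exp_add,
    neg_add_cancel, Complex.exp_zero, ← neg_add, ← two_mul, neg_mul, add_comm]

lemma exp_div_exp_neg_mul {u w b c s : ℂ} (h : u + w = c + (s + b * w)) (d : ℂ) :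
    exp u / (exp (-w) * d) = exp c * (exp s * (exp (b * w) / d)) := by
  rw [← div_div, ← Complex.exp_sub, sub_neg_eq_add, h, Complex.exp_add, Complex.exp_add]
  ring

lemma appellTerm_sub_eq (T : ℝ) (j : ℤ) {a x y k b c α : ℂ} (hα : k + a = j + α)
    (h : -2 * (x * a + y) + (j + α) = c + (-(j : ℂ) ^ 2 + b * (j + α))) :
    e (x * (a * (I * T))) * qPow (I * T) y / (1 - e (a * (I * T)) * qPow (I * T) k) =
      exp (Real.pi * T * c) * ((Real.exp (-(Real.pi * T) * (j : ℝ) ^ 2) : ℂ) *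
        expDivSinh b (Real.pi * T * (j + α))) := by
  have hden := e_mul_qPow T a 1 k
  rw [one_mul, one_mul, add_comm a, hα] at hden
  rw [hden, e_mul_qPow, one_sub_exp_neg_two_mul, expDivSinh]
  push_cast
  exact exp_div_exp_neg_mul (by linear_combination Real.pi * T * h) _

lemma appellTerm_add_eq (T : ℝ) (j : ℤ) {a x y k b c α : ℂ} (hα : k + a = j + α)
    (h : -2 * (x * a + y) + (j + α) = c + (-(j : ℂ) ^ 2 + b * (j + α))) :
    e (x * (a * (I * T))) * qPow (I * T) y / (1 + e (a * (I * T)) * qPow (I * T) k) =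
      exp (Real.pi * T * c) * ((Real.exp (-(Real.pi * T) * (j : ℝ) ^ 2) : ℂ) *
        expDivCosh b (Real.pi * T * (j + α))) := by
  have hden := e_mul_qPow T a 1 k
  rw [one_mul, one_mul, add_comm a, hα] at hden
  rw [hden, e_mul_qPow, one_add_exp_neg_two_mul, expDivCosh]
  push_cast
  exact exp_div_exp_neg_mul (by linear_combination Real.pi * T * h) _

lemma tsum_eq_mul_appellSum {t : ℤ → ℂ} {F : ℂ → ℂ} {α r : ℂ} {T : ℝ}
    (h : ∀ j : ℤ, t j = r * ((Real.exp (-(Real.pi * T) * (j : ℝ) ^ 2) : ℂ) *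
      F (Real.pi * T * (j + α)))) :
    ∑' j, t j = r * appellSum 1 F α T := by
  simp only [h, tsum_mul_left, appellSum, one_zpow, one_mul]

lemma tsum_neg_one_zpow_mul_eq_mul_appellSum {t : ℤ → ℂ} {F : ℂ → ℂ} {α r : ℂ} {T : ℝ}
    (h : ∀ j : ℤ, t j = r * ((Real.exp (-(Real.pi * T) * (j : ℝ) ^ 2) : ℂ) *
      F (Real.pi * T * (j + α)))) :
    ∑' j : ℤ, (-1 : ℂ) ^ j * t j = r * appellSum (-1) F α T := by
  simp only [h, mul_left_comm _ r, tsum_mul_left, appellSum]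

section Specializations

variable (T : ℝ) (a : ℂ)

lemma f₁_eq : f₁ (I * T) (a * (I * T)) =
    exp (Real.pi * T * (2 * a ^ 2)) * appellSum 1 (expDivSinh (1 - 2 * a)) a T :=
  tsum_eq_mul_appellSum fun j => appellTerm_sub_eq T j (by ring) (by ring)

lemma g₁_eq : g₁ (I * T) (a * (I * T)) =
    exp (Real.pi * T * (2 * a ^ 2)) * appellSum 1 (expDivSinh (2 - 2 * a)) a T :=
  tsum_eq_mul_appellSum fun j => appellTerm_sub_eq T j (by ring) (by ring)

lemma h₁_eq : h₁ (I * T) (a * (I * T)) =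
    exp (Real.pi * T * (2 * a ^ 2)) * appellSum (-1) (expDivSinh (1 - 2 * a)) a T :=
  tsum_neg_one_zpow_mul_eq_mul_appellSum fun j => appellTerm_sub_eq T j (by ring) (by ring)

lemma f₃_eq : f₃ (I * T) (a * (I * T)) =
    exp (Real.pi * T * (2 * a ^ 2)) * appellSum (-1) (expDivCosh (1 - 2 * a)) a T :=
  tsum_neg_one_zpow_mul_eq_mul_appellSum fun j => appellTerm_add_eq T j (by ring) (by ring)

lemma g₂_eq : g₂ (I * T) (a * (I * T)) =
    exp (Real.pi * T * (2 * a ^ 2)) * appellSum (-1) (expDivCosh (2 - 2 * a)) a T :=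
  tsum_neg_one_zpow_mul_eq_mul_appellSum fun j => appellTerm_add_eq T j (by ring) (by ring)

lemma h₃_eq : h₃ (I * T) (a * (I * T)) =
    exp (Real.pi * T * (2 * a ^ 2)) * appellSum 1 (expDivCosh (1 - 2 * a)) a T :=
  tsum_eq_mul_appellSum fun j => appellTerm_add_eq T j (by ring) (by ring)

lemma f₄_eq : f₄ (I * T) (a * (I * T)) = exp (Real.pi * T * (2 * (a + 1 / 2) ^ 2 - (a + 1 / 4))) *
    appellSum 1 (expDivSinh (1 - 2 * (a + 1 / 2))) (a + 1 / 2) T :=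
  tsum_eq_mul_appellSum fun j => appellTerm_sub_eq T j (by ring) (by ring)

lemma g₃_eq : g₃ (I * T) (a * (I * T)) = exp (Real.pi * T * (2 * (a + 1 / 2) ^ 2 - (a + 1 / 4))) *
    appellSum 1 (expDivSinh (2 - 2 * (a + 1 / 2))) (a + 1 / 2) T :=
  tsum_eq_mul_appellSum fun j => appellTerm_sub_eq T j (by ring) (by ring)

lemma h₂_eq : h₂ (I * T) (a * (I * T)) = exp (Real.pi * T * (2 * (a + 1 / 2) ^ 2 - (a + 1 / 4))) *
    appellSum (-1) (expDivSinh (1 - 2 * (a + 1 / 2))) (a + 1 / 2) T :=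
  tsum_neg_one_zpow_mul_eq_mul_appellSum fun j => appellTerm_sub_eq T j (by ring) (by ring)

lemma f₂_eq : f₂ (I * T) (a * (I * T)) = exp (Real.pi * T * (2 * (a + 1 / 2) ^ 2 - (a + 1 / 4))) *
    appellSum (-1) (expDivCosh (1 - 2 * (a + 1 / 2))) (a + 1 / 2) T :=
  tsum_neg_one_zpow_mul_eq_mul_appellSum fun j => appellTerm_add_eq T j (by ring) (by ring)

lemma g₄_eq : g₄ (I * T) (a * (I * T)) = exp (Real.pi * T * (2 * (a + 1 / 2) ^ 2 - (a + 1 / 4))) *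
    appellSum (-1) (expDivCosh (2 - 2 * (a + 1 / 2))) (a + 1 / 2) T :=
  tsum_neg_one_zpow_mul_eq_mul_appellSum fun j => appellTerm_add_eq T j (by ring) (by ring)

lemma h₄_eq : h₄ (I * T) (a * (I * T)) = exp (Real.pi * T * (2 * (a + 1 / 2) ^ 2 - (a + 1 / 4))) *
    appellSum 1 (expDivCosh (1 - 2 * (a + 1 / 2))) (a + 1 / 2) T :=
  tsum_eq_mul_appellSum fun j => appellTerm_add_eq T j (by ring) (by ring)

end Specializations

/-! ### Leading asymptotics -/

lemma leadingAsymptotics_of_tendsto {F φ : ℂ → ℂ} {C : ℂ}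
    (h : Tendsto (fun T : ℝ => F (I * T) / φ (I * T)) (𝓝[>] 0) (𝓝 C)) :
    LeadingAsymptotics F C φ := by
  have hlim : Tendsto (fun τ => F τ / φ τ) downZero (𝓝 C) := tendsto_map'_iff.2 h
  refine ⟨hlim, fun hC => isEquivalent_of_tendsto_one ?_⟩
  have hone := hlim.div_const C
  rw [div_self hC] at hone
  exact hone.congr fun τ => by rw [Pi.div_apply, div_div, mul_comm C]

lemma leadingAsymptotics_of_eq_exp_mul {F φ : ℂ → ℂ} {A G : ℝ → ℂ} {c C : ℂ}
    (hF : ∀ T : ℝ, F (I * T) = exp (Real.pi * T * c) * G T)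
    (hφ : ∀ T : ℝ, 0 < T → (φ (I * T))⁻¹ = A T)
    (h : Tendsto (fun T : ℝ => A T * G T) (𝓝[>] 0) (𝓝 C)) :
    LeadingAsymptotics F C φ := by
  have hexp : Tendsto (fun T : ℝ => exp (Real.pi * T * c)) (𝓝[>] 0) (𝓝 1) :=
    Continuous.tendsto' (by fun_prop) 0 1 (by simp) |>.mono_left nhdsWithin_le_nhds
  have hprod := hexp.mul h
  rw [one_mul] at hprod
  refine leadingAsymptotics_of_tendsto (hprod.congr' ?_)
  filter_upwards [self_mem_nhdsWithin] with T hT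
  rw [hF, div_eq_mul_inv, hφ T hT, mul_left_comm, mul_comm]

lemma neg_I_mul_I_mul (z : ℂ) : -I * (I * z) = z := by linear_combination (-z) * I_sq

lemma inv_neg_I_mul_I_mul_cpow_neg_half {T : ℝ} (hT : 0 < T) :
    ((-I * (I * T)) ^ (-(1 / 2) : ℂ))⁻¹ = (√T : ℂ) := by
  rw [neg_I_mul_I_mul, Complex.cpow_neg, inv_inv, Real.sqrt_eq_rpow, ofReal_cpow hT.le]
  norm_num

lemma inv_inv_neg_I_mul_I_mul_mul_exp (T : ℝ) :
    ((-I * (I * T))⁻¹ * exp (-(Real.pi * I) / (4 * (I * T))))⁻¹ =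
      (T : ℂ) * (Real.exp (Real.pi * T⁻¹ / 4) : ℂ) := by
  have hexp : -(Real.pi * I) / (4 * (I * T)) = -(Real.pi * (T : ℂ)⁻¹ / 4) := by
    rw [mul_left_comm, mul_comm (Real.pi : ℂ), ← mul_neg, mul_div_mul_left _ _ I_ne_zero]
    ring
  rw [neg_I_mul_I_mul, hexp, Complex.exp_neg, mul_inv, inv_inv, inv_inv]
  push_cast
  rfl

lemma mem_integerComplement_of_sin_ne_zero {α : ℂ} (hα : sin (α * Real.pi) ≠ 0) :
    α ∈ integerComplement := by
  rintro ⟨n, rfl⟩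
  exact hα (Complex.sin_int_mul_pi n)

lemma leadingAsymptotics_cot {F : ℂ → ℂ} {α b c : ℂ} (hα : sin (α * Real.pi) ≠ 0)
    (hF : ∀ T : ℝ, F (I * T) = exp (Real.pi * T * c) * appellSum 1 (expDivSinh b) α T) :
    LeadingAsymptotics F (1 / 2 * cot (α * Real.pi)) fun τ => (-I * τ)⁻¹ := by
  have hmem := mem_integerComplement_of_sin_ne_zero hα
  have hlim := tendsto_mul_appellSum_expDivSinh hmem (one_pow 2) b
  simp only [one_zpow, one_mul, (hasSum_div_sq_sub_int_sq hmem).tsum_eq] at hlim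
  have hC : (2 * Real.pi : ℂ)⁻¹ * (Real.pi * cot (Real.pi * α)) = 1 / 2 * cot (α * Real.pi) := by
    rw [mul_comm α]
    field_simp [ofReal_ne_zero.2 Real.pi_ne_zero]
  rw [hC] at hlim
  exact leadingAsymptotics_of_eq_exp_mul hF (fun T _ => by rw [inv_inv, neg_I_mul_I_mul]) hlim

lemma leadingAsymptotics_inv_sin {F : ℂ → ℂ} {α b c : ℂ} (hα : sin (α * Real.pi) ≠ 0)
    (hF : ∀ T : ℝ, F (I * T) = exp (Real.pi * T * c) * appellSum (-1) (expDivSinh b) α T) :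
    LeadingAsymptotics F (1 / (2 * sin (α * Real.pi))) fun τ => (-I * τ)⁻¹ := by
  have hmem := mem_integerComplement_of_sin_ne_zero hα
  have hlim := tendsto_mul_appellSum_expDivSinh hmem neg_one_sq b
  have hC : (2 * Real.pi : ℂ)⁻¹ * (Real.pi / sin (Real.pi * α)) = 1 / (2 * sin (α * Real.pi)) := by
    rw [mul_comm α]
    field_simp [ofReal_ne_zero.2 Real.pi_ne_zero]
  rw [tsum_neg_one_zpow_mul_div_sq_sub_int_sq hmem, hC] at hlim
  exact leadingAsymptotics_of_eq_exp_mul hF (fun T _ => by rw [inv_inv, neg_I_mul_I_mul]) hlim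

lemma leadingAsymptotics_half {F : ℂ → ℂ} {α b c : ℂ}
    (hF : ∀ T : ℝ, F (I * T) = exp (Real.pi * T * c) * appellSum 1 (expDivCosh b) α T) :
    LeadingAsymptotics F (1 / 2) fun τ => (-I * τ) ^ (-(1 / 2) : ℂ) :=
  leadingAsymptotics_of_eq_exp_mul hF (fun _ hT => inv_neg_I_mul_I_mul_cpow_neg_half hT)
    (tendsto_sqrt_mul_appellSum_expDivCosh b α)

lemma leadingAsymptotics_cos {F : ℂ → ℂ} {α b c : ℂ}
    (hF : ∀ T : ℝ, F (I * T) = exp (Real.pi * T * c) * appellSum (-1) (expDivCosh b) α T) :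
    LeadingAsymptotics F (cos (Real.pi * b / 2))
      fun τ => (-I * τ)⁻¹ * exp (-(Real.pi * I) / (4 * τ)) :=
  leadingAsymptotics_of_eq_exp_mul hF (fun T _ => inv_inv_neg_I_mul_I_mul_mul_exp T)
    (tendsto_mul_exp_mul_appellSum_neg_one_expDivCosh b α)

lemma cos_pi_mul_one_sub_two_mul_div_two (α : ℂ) :
    cos (Real.pi * (1 - 2 * α) / 2) = sin (α * Real.pi) := by
  rw [← Complex.cos_pi_div_two_sub]; congr 1; ring

lemma cos_pi_mul_two_sub_two_mul_div_two (α : ℂ) :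
    cos (Real.pi * (2 - 2 * α) / 2) = -cos (α * Real.pi) := by
  rw [← Complex.cos_pi_sub]; congr 1; ring

lemma sin_add_half_mul_pi (a : ℂ) : sin ((a + 1 / 2) * Real.pi) = cos (a * Real.pi) := by
  rw [← Complex.sin_add_pi_div_two]; congr 1; ring

lemma cos_add_half_mul_pi (a : ℂ) : cos ((a + 1 / 2) * Real.pi) = -sin (a * Real.pi) := by
  rw [← Complex.cos_add_pi_div_two]; congr 1; ring

lemma half_mul_cot_add_half_mul_pi (a : ℂ) :
    1 / 2 * cot ((a + 1 / 2) * Real.pi) = -(1 / 2) * tan (a * Real.pi) := by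
  rw [cot_eq_cos_div_sin, sin_add_half_mul_pi, cos_add_half_mul_pi, tan_eq_sin_div_cos]
  ring

end Appell

end

theorem mainTheorem7 (a : ℂ) :
    -- the functions whose denominators contain `1 - e^{2πiz} q^j`: `a` is not an integer
    (Complex.sin (a * Real.pi) ≠ 0 →
      Appell.LeadingAsymptotics (fun τ => Appell.f₁ τ (a * τ))
        (1 / 2 * Complex.cot (a * Real.pi)) (fun τ => (-Complex.I * τ)⁻¹) ∧
      Appell.LeadingAsymptotics (fun τ => Appell.g₁ τ (a * τ))
        (1 / 2 * Complex.cot (a * Real.pi)) (fun τ => (-Complex.I * τ)⁻¹) ∧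
      Appell.LeadingAsymptotics (fun τ => Appell.h₁ τ (a * τ))
        (1 / (2 * Complex.sin (a * Real.pi))) (fun τ => (-Complex.I * τ)⁻¹)) ∧
    -- those with `1 - e^{2πiz} q^{j+1/2}`: `a + 1/2` is not an integer
    (Complex.cos (a * Real.pi) ≠ 0 →
      Appell.LeadingAsymptotics (fun τ => Appell.f₄ τ (a * τ))
        (-(1 / 2) * Complex.tan (a * Real.pi)) (fun τ => (-Complex.I * τ)⁻¹) ∧
      Appell.LeadingAsymptotics (fun τ => Appell.g₃ τ (a * τ))
        (-(1 / 2) * Complex.tan (a * Real.pi)) (fun τ => (-Complex.I * τ)⁻¹) ∧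
      Appell.LeadingAsymptotics (fun τ => Appell.h₂ τ (a * τ))
        (1 / (2 * Complex.cos (a * Real.pi))) (fun τ => (-Complex.I * τ)⁻¹)) ∧
    -- the remaining ones, for every complex `a`
    Appell.LeadingAsymptotics (fun τ => Appell.f₂ τ (a * τ)) (Complex.cos (a * Real.pi))
      (fun τ => (-Complex.I * τ)⁻¹ * Complex.exp (-(Real.pi * Complex.I) / (4 * τ))) ∧
    Appell.LeadingAsymptotics (fun τ => Appell.f₃ τ (a * τ)) (Complex.sin (a * Real.pi))
      (fun τ => (-Complex.I * τ)⁻¹ * Complex.exp (-(Real.pi * Complex.I) / (4 * τ))) ∧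
    Appell.LeadingAsymptotics (fun τ => Appell.g₂ τ (a * τ)) (-Complex.cos (a * Real.pi))
      (fun τ => (-Complex.I * τ)⁻¹ * Complex.exp (-(Real.pi * Complex.I) / (4 * τ))) ∧
    Appell.LeadingAsymptotics (fun τ => Appell.g₄ τ (a * τ)) (Complex.sin (a * Real.pi))
      (fun τ => (-Complex.I * τ)⁻¹ * Complex.exp (-(Real.pi * Complex.I) / (4 * τ))) ∧
    Appell.LeadingAsymptotics (fun τ => Appell.h₃ τ (a * τ)) (1 / 2)
      (fun τ => (-Complex.I * τ) ^ (-(1 / 2) : ℂ)) ∧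
    Appell.LeadingAsymptotics (fun τ => Appell.h₄ τ (a * τ)) (1 / 2)
      (fun τ => (-Complex.I * τ) ^ (-(1 / 2) : ℂ)) := by
  open Appell in
  refine ⟨fun ha => ⟨leadingAsymptotics_cot ha fun T => f₁_eq T a,
    leadingAsymptotics_cot ha fun T => g₁_eq T a,
    leadingAsymptotics_inv_sin ha fun T => h₁_eq T a⟩, fun ha => ?_, ?_, ?_, ?_, ?_,
    leadingAsymptotics_half fun T => h₃_eq T a, leadingAsymptotics_half fun T => h₄_eq T a⟩
  · rw [← half_mul_cot_add_half_mul_pi]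
    rw [← sin_add_half_mul_pi] at ha ⊢
    exact ⟨leadingAsymptotics_cot ha fun T => f₄_eq T a,
      leadingAsymptotics_cot ha fun T => g₃_eq T a,
      leadingAsymptotics_inv_sin ha fun T => h₂_eq T a⟩
  · rw [← sin_add_half_mul_pi, ← cos_pi_mul_one_sub_two_mul_div_two]
    exact leadingAsymptotics_cos fun T => f₂_eq T a
  · rw [← cos_pi_mul_one_sub_two_mul_div_two]
    exact leadingAsymptotics_cos fun T => f₃_eq T a
  · rw [← cos_pi_mul_two_sub_two_mul_div_two]
    exact leadingAsymptotics_cos fun T => g₂_eq T a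
  · rw [← neg_neg (Complex.sin _), ← cos_add_half_mul_pi, ← cos_pi_mul_two_sub_two_mul_div_two]
    exact leadingAsymptotics_cos fun T => g₄_eq T a
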